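/- **Setting.** A *triangular decomposition* $\mathfrak T$ of a compact surface $M$ (possibly with boundary) presents $M$ as a finite set $F$ of triangles whose sides are glued in pairs; sides that are not glued form the boundary edges. (Two sides of one triangle may be glued to each other; in particular every cell decomposition of $M$ that lifts to a triangulation of the universal cover is of this kind.) Let $E,\partial E,V,\partial V$ be the sets of edges, boundary edges, vertices, boundary vertices. Points $x\in\mathbb R^{3F}$ assign a real number ("angle") to each corner of each triangle. * An *angle system* is a point of the set $\mathfrak N$ of all $x\in\mathbb R^{3F}$ such that all angles lie in $(0,\pi)$, the three angles of each triangle have sum $<\pi$, and the angles at each vertex (each corner at the vertex counted once) sum to $2\pi$ if the vertex is interior and to $\pi$ if it lies in $\partial V$. (If $\mathfrak N\neq\emptyset$ and $F\ne\emptyset$ then necessarily $\chi(M)<0$.) * For an interior edge $e$ let $w_e\in\mathbb R^{3F}$ be the sum of the unit vectors of the two corners adjacent to $e$ on one side of $e$, minus the same sum for the other side of $e$. Let $C=\operatorname{span}\{w_e: e\in E-\partial E\}$; $x$ and $y$ are *conformally equivalent* if $x-y\in C$. * For a side $e$ of a triangle $t$ put $\psi^e_t(x)=\tfrac12(B+C-A)$,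 where $A$ is the angle of $x$ in $t$ opposite to $e$ and $B,C$ are the two angles adjacent to $e$. Let $\psi^e=\psi^e_{t_1}+\psi^e_{t_2}$ for an interior edge (sum over its two sides), $\psi^e=\psi^e_t$ for a boundary edge, and $\Psi(x)=(\psi^e(x))_{e\in E}\in\mathbb R^E$. * An angle system $u$ is *uniform* if the hyperbolic triangles with the angles prescribed by $u$ fit together, i.e. any two sides that are glued have the same hyperbolic length (so that the triangles form a hyperbolic structure on $M$ with geodesic boundary). A point $p\in\mathbb R^E$ is an *ideal disk pattern* if $p=\Psi(u)$ for some uniform angle system $u$. * The set of *Delaunay angle systems* is $\mathfrak D=\{x\in\mathfrak N:\Psi(x)\in(0,\pi)^{E-\partial E}\times(0,\tfrac{\pi}{2})^{\partial E}\}$. **Corollary 2.6.** Every Delaunay angle system $x\in\mathfrak D$ has a unique ideal disk pattern associated to it. That is, there is exactly one uniform angle system $u$ conformally equivalent to $x$; the point $\Psi(x)$ is an ideal disk pattern; and there is exactly one uniform angle system $u$ with $\Psi(u)=\Psi(x)$. -/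

import Mathlib

/-- A (finite) triangular decomposition of a compact surface, possibly with boundary, recorded by
its combinatorics: `F` is the set of triangles, every triangle has corners `0, 1, 2 : Fin 3`, and
the surface is obtained from disjoint triangles by gluing sides in pairs.

A pair `s = (t, i) : F × Fin 3` names both the corner `i` of `t` and the side of `t` opposite to
that corner; this side has first endpoint `(t, i + 1)` and second endpoint `(t, i + 2)`.
The involution `mate` tells which side is glued to which; its fixed points are the sides lying on
the boundary of the surface. A side is glued to its mate first endpoint to second endpoint and
second to first when `twist` is `false`, and first to first, second to second when `twist` is
`true` (so that non-orientable surfaces are allowed). The value of `twist` at a boundary side is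
irrelevant.

Two sides of one triangle may be glued to each other and triangles may share several vertices, as
is possible for a cell decomposition that becomes a triangulation only in the universal cover. -/
structure TriangularDecomposition (F : Type*) where
  mate : F × Fin 3 → F × Fin 3
  mate_mate : ∀ s, mate (mate s) = s
  twist : F × Fin 3 → Bool
  twist_mate : ∀ s, twist (mate s) = twist s

namespace TriangularDecomposition

variable {F : Type*}

/-! ### Edges and vertices of the surface -/

/-- The first endpoint of a side, as a corner of its triangle. -/
def fstEnd (s : F × Fin 3) : F × Fin 3 := (s.1, s.2 + 1)

/-- The second endpoint of a side, as a corner of its triangle. -/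
def sndEnd (s : F × Fin 3) : F × Fin 3 := (s.1, s.2 + 2)

/-- Two sides are the same edge of the surface when they are equal or glued to each other. -/
def edgeSetoid (T : TriangularDecomposition F) : Setoid (F × Fin 3) where
  r s s' := s' = s ∨ s' = T.mate s
  iseqv :=
    { refl := fun _ => Or.inl rfl
      symm := by
        rintro s s' (h | h)
        · exact Or.inl h.symm
        · right; rw [h, T.mate_mate]
      trans := by
        rintro s s' s'' (h | h) (h' | h')
        · left; rw [h', h]
        · right; rw [h', h]
        · right; rw [h', h]
        · left; rw [h', h, T.mate_mate] }

/-- The set `E` of edges of the surface. -/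
def Edge (T : TriangularDecomposition F) : Type _ := Quotient T.edgeSetoid

/-- The edge of the surface on which a side of a triangle lies. -/
def edgeOf (T : TriangularDecomposition F) (s : F × Fin 3) : T.Edge :=
  Quotient.mk T.edgeSetoid s

/-- Membership in the set `∂E` of boundary edges. -/
def IsBoundaryEdge (T : TriangularDecomposition F) (e : T.Edge) : Prop :=
  ∃ s, T.edgeOf s = e ∧ T.mate s = s

/-- The elementary identifications of corners: the endpoints of a side that is not on the boundary
are identified with the endpoints of the side glued to it, in the way given by `twist`. -/
inductive CornerGlued (T : TriangularDecomposition F) : F × Fin 3 → F × Fin 3 → Prop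
  | fst_snd (s : F × Fin 3) (hs : T.mate s ≠ s) (ht : T.twist s = false) :
      CornerGlued T (fstEnd s) (sndEnd (T.mate s))
  | snd_fst (s : F × Fin 3) (hs : T.mate s ≠ s) (ht : T.twist s = false) :
      CornerGlued T (sndEnd s) (fstEnd (T.mate s))
  | fst_fst (s : F × Fin 3) (hs : T.mate s ≠ s) (ht : T.twist s = true) :
      CornerGlued T (fstEnd s) (fstEnd (T.mate s))
  | snd_snd (s : F × Fin 3) (hs : T.mate s ≠ s) (ht : T.twist s = true) :
      CornerGlued T (sndEnd s) (sndEnd (T.mate s))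

/-- The set `V` of vertices of the surface: corners modulo the equivalence relation generated by
the elementary identifications. -/
def Vertex (T : TriangularDecomposition F) : Type _ := Quot T.CornerGlued

/-- The vertex of the surface at which a corner of a triangle lies. -/
def vertexOf (T : TriangularDecomposition F) (c : F × Fin 3) : T.Vertex := Quot.mk _ c

/-- Membership in the set `∂V` of boundary vertices: the vertices that are an endpoint of a
boundary edge. -/
def IsBoundaryVertex (T : TriangularDecomposition F) (v : T.Vertex) : Prop :=
  ∃ s, T.mate s = s ∧ (T.vertexOf (fstEnd s) = v ∨ T.vertexOf (sndEnd s) = v)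

/-! ### Angle systems -/

open Classical in
/-- `p^v(x)`: the sum of the angles at the vertex `v`, each corner lying at `v` counted once
(that is, the angles of the flower at a lift of `v` to the universal cover). -/
noncomputable def angleSum [Fintype F] (T : TriangularDecomposition F) (v : T.Vertex)
    (x : F × Fin 3 → ℝ) : ℝ :=
  ∑ c with T.vertexOf c = v, x c

/-- `k^t(x) = σ^t(x) - π`. -/
noncomputable def curvature (t : F) (x : F × Fin 3 → ℝ) : ℝ :=
  x (t, 0) + x (t, 1) + x (t, 2) - Real.pi

/-- The affine flat `𝔙`: angles sum to `2π` at interior and to `π` at boundary vertices. -/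
def angleFlat [Fintype F] (T : TriangularDecomposition F) : Set (F × Fin 3 → ℝ) :=
  {x | (∀ v, ¬ T.IsBoundaryVertex v → T.angleSum v x = 2 * Real.pi) ∧
    ∀ v, T.IsBoundaryVertex v → T.angleSum v x = Real.pi}

/-- The set `𝔑` of angle systems. -/
def angleSystems [Fintype F] (T : TriangularDecomposition F) : Set (F × Fin 3 → ℝ) :=
  {x | x ∈ T.angleFlat ∧ (∀ t, curvature t x < 0) ∧ ∀ c, x c ∈ Set.Ioo 0 Real.pi}

/-! ### Conformal equivalence -/

open Classical in
/-- The vector with entry `1` at the two corners of a triangle adjacent to the side `s`, and `0`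
at all other corners. -/
noncomputable def sideVector (s : F × Fin 3) : F × Fin 3 → ℝ :=
  fun c => if c = fstEnd s ∨ c = sndEnd s then 1 else 0

/-- The vector `w_e` of the edge `e` on which `s` lies: `+1` at the two corners adjacent to `e` on
one side of `e` and `-1` at the two corners adjacent to `e` on the other side.
(Passing from `s` to its mate changes the sign.) -/
noncomputable def edgeVector (T : TriangularDecomposition F) (s : F × Fin 3) : F × Fin 3 → ℝ :=
  sideVector s - sideVector (T.mate s)

/-- The space `C` of conformal deformations, spanned by the `w_e` with `e` an interior edge. -/
def conformalSpace (T : TriangularDecomposition F) : Submodule ℝ (F × Fin 3 → ℝ) :=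
  Submodule.span ℝ {w | ∃ s, T.mate s ≠ s ∧ w = T.edgeVector s}

/-- `x` and `y` are conformally equivalent. -/
def ConformallyEquivalent (T : TriangularDecomposition F) (x y : F × Fin 3 → ℝ) : Prop :=
  x - y ∈ T.conformalSpace

/-! ### Hyperbolic realizations and uniform angle systems -/

/-- The coordinate of `z` in the Poincaré disk model centred at `p`: the conformal isometry
`z ↦ (z - p) / (z - conj p)` from the upper half-plane to the unit disk sends `p` to `0` and the
geodesic rays from `p` to straight radii. -/
noncomputable def diskCoord (p z : UpperHalfPlane) : ℂ :=
  ((z : ℂ) - (p : ℂ)) / ((z : ℂ) - (starRingEnd ℂ) (p : ℂ))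

/-- The hyperbolic angle at `p` between the geodesic rays from `p` to `q` and from `p` to `r`
(for `q` and `r` different from `p`). -/
noncomputable def hypAngle (p q r : UpperHalfPlane) : ℝ :=
  InnerProductGeometry.angle (diskCoord p q) (diskCoord p r)

/-- `P` lists the vertices of a hyperbolic triangle, in Mathlib's hyperbolic plane, whose angle at
the vertex `P i` is `A i`. -/
def IsHyperbolicTriangle (A : Fin 3 → ℝ) (P : Fin 3 → UpperHalfPlane) : Prop :=
  Function.Injective P ∧ ∀ i, hypAngle (P i) (P (i + 1)) (P (i + 2)) = A i

/-- The hyperbolic length of the side opposite to the vertex `P i`. -/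
noncomputable def sideLength (P : Fin 3 → UpperHalfPlane) (i : Fin 3) : ℝ :=
  dist (P (i + 1)) (P (i + 2))

/-- `u` is a uniform angle system: the hyperbolic triangles with the angles prescribed by `u` fit
together, that is, any two sides that are glued have the same hyperbolic length. (As the angles
of `u` sum to `2π` at interior and to `π` at boundary vertices, the glued triangles then form a
hyperbolic structure with geodesic boundary. A hyperbolic triangle is determined by its angles up
to isometry, so it does not matter which triangles are chosen.) -/
def IsUniform [Fintype F] (T : TriangularDecomposition F) (u : F × Fin 3 → ℝ) : Prop :=
  u ∈ T.angleSystems ∧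
    ∃ P : F → Fin 3 → UpperHalfPlane,
      (∀ t, IsHyperbolicTriangle (fun i => u (t, i)) (P t)) ∧
      ∀ s, sideLength (P s.1) s.2 = sideLength (P (T.mate s).1) (T.mate s).2

/-! ### Ideal disk patterns and Delaunay angle systems -/

/-- `ψ^e_t(x) = (B + C - A) / 2`, where `A` is the angle of `t` opposite to the side and `B`, `C`
are the angles adjacent to it. -/
noncomputable def sidePsi (s : F × Fin 3) (x : F × Fin 3 → ℝ) : ℝ :=
  (x (fstEnd s) + x (sndEnd s) - x s) / 2

open Classical in
/-- `Ψ(x)`, whose coordinate `ψ^e(x)` at an edge is the sum of `ψ^e_t(x)` over the sides lying on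
`e`: two sides for an interior edge, one side for a boundary edge. -/
noncomputable def Psi [Fintype F] (T : TriangularDecomposition F) (x : F × Fin 3 → ℝ) :
    T.Edge → ℝ :=
  fun e => ∑ s with T.edgeOf s = e, sidePsi s x

/-- A point of `ℝ^E` is an ideal disk pattern when it is `Ψ(u)` for a uniform angle system `u`. -/
def IsIdealDiskPattern [Fintype F] (T : TriangularDecomposition F) (p : T.Edge → ℝ) : Prop :=
  ∃ u, T.IsUniform u ∧ T.Psi u = p

/-- The set `𝔇` of Delaunay angle systems. -/
def delaunaySystems [Fintype F] (T : TriangularDecomposition F) : Set (F × Fin 3 → ℝ) :=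
  {x | x ∈ T.angleSystems ∧
    (∀ e, ¬ T.IsBoundaryEdge e → T.Psi x e ∈ Set.Ioo 0 Real.pi) ∧
    ∀ e, T.IsBoundaryEdge e → T.Psi x e ∈ Set.Ioo 0 (Real.pi / 2)}

end TriangularDecomposition

/-! The proof is variational. In the coordinates `sidePsi`, conformal equivalence fixes the sum of
the two coordinates on each interior edge and the single coordinate on each boundary edge, so
conformal classes are exactly the fibers of `Psi` (`Psi_eq_iff`), and both uniqueness claims are the
same. On a class, consider `prismVolume`, a sum of Lobachevsky functions of affine functions of the
angles. Its partial derivative in the coordinate of a side is `sideLog`, the logarithm of `sinh² (a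
/ 2)` for the length `a` that the angles give to that side (`hasDerivAt_prismVolume`). Moving along
`w_e` therefore changes the volume at a rate equal to the jump of `sideLog` across `e`: the critical
points in the class are the uniform angle systems (`isUniform_iff`). Uniqueness comes from strict
concavity, in the form of strict monotonicity of the gradient on each triangle
(`logSinhSq_strictMono`, resting on `prism_hessian_pos`). Existence: the volume attains a maximum on
the compact closure of the class. The Lobachevsky function has infinite slope at `0`, so no argument
vanishes at the maximum (`pos_of_sum_lobachevsky_le`). This needs all arguments to stay below `π`,
which is where the Delaunay condition enters (`prismAngle_lt_pi`). -/

section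

open Real Filter Topology UpperHalfPlane

/-! ### The Lobachevsky function and its infinite slope at zero -/

/-- A primitive of `-log ∘ sin`: the Lobachevsky function up to a linear term. -/
noncomputable def lobachevsky (x : ℝ) : ℝ := -∫ t in (0 : ℝ)..x, log (sin t)

lemma hasDerivAt_lobachevsky {x : ℝ} (h0 : 0 < x) (h1 : x < π) :
    HasDerivAt lobachevsky (-log (sin x)) x := by
  have hs : sin x ≠ 0 := (sin_pos_of_pos_of_lt_pi h0 h1).ne'
  refine (intervalIntegral.integral_hasDerivAt_right intervalIntegrable_log_sin ?_ ?_).neg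
  · exact (Real.measurable_log.comp Real.measurable_sin).stronglyMeasurable.stronglyMeasurableAtFilter
  · exact (continuousAt_log hs).comp continuous_sin.continuousAt

lemma continuous_lobachevsky : Continuous lobachevsky :=
  (intervalIntegral.continuous_primitive (fun _ _ => intervalIntegrable_log_sin) 0).neg

lemma lobachevsky_zero : lobachevsky 0 = 0 := by simp [lobachevsky]

/-- The integrand `-log ∘ sin` decreases on `(0, π / 2]`, so the integral is at least the length of
the interval times the value at its right end. -/
lemma mul_neg_log_sin_le_lobachevsky {x : ℝ} (h0 : 0 < x) (h1 : x ≤ π / 2) :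
    x * (-log (sin x)) ≤ lobachevsky x := by
  have h : ∫ t in (0 : ℝ)..x, log (sin t) ≤ ∫ t in (0 : ℝ)..x, log (sin x) := by
    refine intervalIntegral.integral_mono_on_of_le_Ioo h0.le intervalIntegrable_log_sin (by simp) ?_
    intro t ht
    have := pi_pos
    exact log_le_log (sin_pos_of_pos_of_lt_pi ht.1 (by linarith [ht.2]))
      (sin_le_sin_of_le_of_le_pi_div_two (by linarith [ht.1]) h1 ht.2.le)
  rw [intervalIntegral.integral_const] at h
  simp only [sub_zero, smul_eq_mul] at h
  unfold lobachevsky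
  linarith

lemma tendsto_lobachevsky_slope_zero {b : ℝ} (hb : 0 < b) :
    Tendsto (fun s => lobachevsky (s * b) / s) (𝓝[>] 0) atTop := by
  have h1 : Tendsto (fun s : ℝ => sin (s * b)) (𝓝[>] 0) (𝓝[>] 0) := by
    refine tendsto_nhdsWithin_iff.2 ⟨?_, ?_⟩
    · have : Continuous fun s : ℝ => sin (s * b) := by fun_prop
      simpa using this.continuousAt.tendsto.mono_left (nhdsWithin_le_nhds (a := (0 : ℝ)))
    · have : Set.Ioo (0 : ℝ) (π / b) ∈ 𝓝[>] (0 : ℝ) := Ioo_mem_nhdsGT (by positivity)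
      filter_upwards [this] with s hs
      exact sin_pos_of_pos_of_lt_pi (mul_pos hs.1 hb) ((lt_div_iff₀ hb).1 hs.2)
  have h2 : Tendsto (fun s : ℝ => b * -log (sin (s * b))) (𝓝[>] 0) atTop :=
    (tendsto_neg_atBot_atTop.comp (tendsto_log_nhdsGT_zero.comp h1)).const_mul_atTop hb
  refine tendsto_atTop_mono' _ ?_ h2
  have : Set.Ioo (0 : ℝ) (π / 2 / b) ∈ 𝓝[>] (0 : ℝ) := Ioo_mem_nhdsGT (by positivity)
  filter_upwards [this] with s hs
  rw [le_div_iff₀ hs.1]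
  have := mul_neg_log_sin_le_lobachevsky (mul_pos hs.1 hb) ((le_div_iff₀ hb).1 hs.2.le)
  linarith

/-- A sum of Lobachevsky functions of affine functions of `s ∈ [0, 1]` that are positive at `1`
is not maximal at `0` unless all of these functions are positive at `0`. -/
lemma pos_of_sum_lobachevsky_le {J : Type*} [Fintype J] (a b : J → ℝ) (ha : ∀ j, 0 ≤ a j)
    (ha' : ∀ j, a j < π) (hb : ∀ j, 0 < b j)
    (hmax : ∀ s ∈ Set.Ioo (0 : ℝ) 1,
      ∑ j, lobachevsky (a j + s * (b j - a j)) ≤ ∑ j, lobachevsky (a j)) (j : J) : 0 < a j := by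
  by_contra hj
  replace hj : a j = 0 := le_antisymm (not_lt.1 hj) (ha j)
  -- Every difference quotient at `0` is bounded below: where `a k = 0` it tends to infinity,
  -- elsewhere it converges because `a k` lies in `(0, π)`.
  have hlow : ∀ k, ∃ C : ℝ, ∀ᶠ s in 𝓝[>] (0 : ℝ),
      C ≤ (lobachevsky (a k + s * (b k - a k)) - lobachevsky (a k)) / s := by
    intro k
    rcases (ha k).eq_or_lt with h | h
    · refine ⟨0, ?_⟩
      have := (tendsto_lobachevsky_slope_zero (hb k)).eventually_ge_atTop 0
      simpa [← h, lobachevsky_zero] using this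
    · have hl : HasDerivAt (fun s : ℝ => a k + s * (b k - a k)) (b k - a k) 0 := by
        simpa using ((hasDerivAt_id (0 : ℝ)).mul_const (b k - a k)).const_add (a k)
      have hd := (HasDerivAt.comp (0 : ℝ) (h₂ := lobachevsky)
        (by simpa using hasDerivAt_lobachevsky h (ha' k)) hl)
      have ht := hd.tendsto_slope_zero_right
      refine ⟨-log (sin (a k)) * (b k - a k) - 1, ?_⟩
      filter_upwards [ht.eventually (eventually_ge_nhds (sub_one_lt _))] with s hs
      simpa [div_eq_inv_mul] using hs
  choose C hC using hlow
  -- The bound for `j` is chosen so that all the lower bounds add up to exactly `1`, whereas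
  -- maximality makes the sum of the quotients at most `0`.
  have hj' : ∀ᶠ s in 𝓝[>] (0 : ℝ), 1 - ∑ k, C k + C j ≤
      (lobachevsky (a j + s * (b j - a j)) - lobachevsky (a j)) / s := by
    have := (tendsto_lobachevsky_slope_zero (hb j)).eventually_ge_atTop (1 - ∑ k, C k + C j)
    simpa [hj, lobachevsky_zero] using this
  have hI : Set.Ioo (0 : ℝ) 1 ∈ 𝓝[>] (0 : ℝ) := Ioo_mem_nhdsGT one_pos
  obtain ⟨s, hs, hsC, hsj⟩ := (eventually_mem_set.2 hI |>.and
    ((eventually_all.2 hC).and hj')).exists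
  have h1 : ∑ k, (lobachevsky (a k + s * (b k - a k)) - lobachevsky (a k)) / s ≤ 0 := by
    rw [← Finset.sum_div, Finset.sum_sub_distrib]
    exact div_nonpos_of_nonpos_of_nonneg (sub_nonpos.2 (hmax s hs)) hs.1.le
  classical
  have h2 := Finset.sum_le_sum (s := Finset.univ.erase j) fun k _ => hsC k
  rw [← Finset.add_sum_erase _ _ (Finset.mem_univ j)] at h1
  have h3 := Finset.add_sum_erase Finset.univ C (Finset.mem_univ j)
  linarith

/-! ### Concavity of the volume of an ideal prism -/

/-- Sylvester's criterion for the symmetric matrix with diagonal `m, n, k` and all other entries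
`1`; the hypotheses are its leading minors, and completing squares proves it. -/
lemma ternary_form_pos {m n k x y z : ℝ} (h1 : 0 < m) (h2 : 0 < m * n - 1)
    (h3 : 0 < m * n * k + 2 - m - n - k) (h : x ≠ 0 ∨ y ≠ 0 ∨ z ≠ 0) :
    0 < m * x ^ 2 + n * y ^ 2 + k * z ^ 2 + 2 * (x * y + y * z + z * x) := by
  have key : m * (m * n - 1) *
      (m * x ^ 2 + n * y ^ 2 + k * z ^ 2 + 2 * (x * y + y * z + z * x)) =
      (m * n - 1) * (m * x + y + z) ^ 2 + ((m * n - 1) * y + (m - 1) * z) ^ 2 +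
        m * (m * n * k + 2 - m - n - k) * z ^ 2 := by ring
  refine pos_of_mul_pos_right (a := m * (m * n - 1)) ?_ (by positivity)
  rw [key]
  by_cases hz : z = 0
  · by_cases hy : y = 0
    · have hx : x ≠ 0 := by tauto
      subst hz hy
      have : 0 < (m * x + 0 + 0) ^ 2 := by
        have : m * x ≠ 0 := mul_ne_zero h1.ne' hx
        rw [add_zero, add_zero]; positivity
      positivity
    · subst hz
      have : 0 < ((m * n - 1) * y + (m - 1) * 0) ^ 2 := by
        have : (m * n - 1) * y ≠ 0 := mul_ne_zero h2.ne' hy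
        rw [mul_zero, add_zero]; positivity
      positivity
  · positivity

/-- The logarithm of `sinh² (a / 2)`, where `a` is the length of the side of a hyperbolic triangle
whose angles are `y + z`, `x + z` (at the side) and `x + y` in terms of the coordinates `ψ`. -/
noncomputable def logSinhSq (x y z : ℝ) : ℝ :=
  log (cos (x + y + z)) + log (cos x) - log (sin (x + z)) - log (sin (x + y))

/-- Gives the off-diagonal entries of the Hessian; the numerator is the cosine of `(x + y + z) - (x
+ y)`. -/
lemma tan_add_cot_add {x y z : ℝ} (hP : cos (x + y + z) ≠ 0) (hxy : sin (x + y) ≠ 0) :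
    sin (x + y + z) / cos (x + y + z) + cos (x + y) / sin (x + y) =
      cos z / (cos (x + y + z) * sin (x + y)) := by
  have h : cos z = cos (x + y + z) * cos (x + y) + sin (x + y + z) * sin (x + y) := by
    rw [← cos_sub]; ring_nf
  rw [h]
  field_simp
  ring

lemma prism_hessian_diagonal {x y z : ℝ} (hP : cos (x + y + z) ≠ 0) (hx : cos x ≠ 0)
    (hxy : sin (x + y) ≠ 0) (hzx : sin (z + x) ≠ 0) :
    sin (x + y + z) / cos (x + y + z) + sin x / cos x + cos (x + y) / sin (x + y)
      + cos (z + x) / sin (z + x) =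
      cos y * cos z * sin (x + y + (z + x)) /
        (cos (x + y + z) * cos x * sin (z + x) * sin (x + y)) := by
  have h1 := tan_add_cot_add hP hxy
  have h2 : sin x / cos x + cos (z + x) / sin (z + x) = cos z / (cos x * sin (z + x)) := by
    have h : cos z = cos (z + x) * cos x + sin (z + x) * sin x := by
      rw [← cos_sub]; ring_nf
    rw [h]
    field_simp
    ring
  have h3 : cos x * sin (z + x) + cos (x + y + z) * sin (x + y) =
      sin (x + y + (z + x)) * cos y := by
    have e1 : z + x = (x + z) := by ring
    have e2 : x + y + z = (x + z) + y := by ring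
    have e3 : x + y + (z + x) = (x + z) + y + x := by ring
    rw [e3, e2, e1]
    generalize x + z = a
    simp only [sin_add, cos_add]
    linear_combination (-cos x * sin a) * sin_sq_add_cos_sq y
  have h4 : cos z / (cos (x + y + z) * sin (x + y)) + cos z / (cos x * sin (z + x)) =
      cos z * (cos x * sin (z + x) + cos (x + y + z) * sin (x + y)) /
        (cos (x + y + z) * cos x * sin (z + x) * sin (x + y)) := by
    field_simp
  rw [h3] at h4
  linear_combination h1 + h2 + h4

/-- Evaluates the second leading minor in `prism_hessian_pos`. -/
lemma sin_add_mul_sin_add_sub (a b c : ℝ) :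
    sin (c + b) * sin (c + a) - sin a * sin b = sin c * sin (a + b + c) := by
  simp only [sin_add, cos_add]
  linear_combination (sin a * sin b) * sin_sq_add_cos_sq c

/-- Together with `sin_add_add_eq`, this evaluates the determinant in `prism_hessian_pos` as `4 *
cos (x + y + z) ^ 2`. -/
lemma sin_add_mul_sin_add_mul_sin_add (x y z : ℝ) :
    2 * cos (x + y + z) * sin x * sin y * sin z + sin x * sin y * sin (x + y)
      + sin y * sin z * sin (y + z) + sin z * sin x * sin (z + x) =
      sin (x + y) * sin (y + z) * sin (z + x) := by
  simp only [sin_add, cos_add]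
  linear_combination (-sin y * cos y * sin z ^ 2 - sin z * cos z * sin y ^ 2) * sin_sq_add_cos_sq x
    + (-sin x * cos x * sin z ^ 2 - sin z * cos z * sin x ^ 2) * sin_sq_add_cos_sq y
    + (-sin y * cos y * sin x ^ 2 - sin x * cos x * sin y ^ 2) * sin_sq_add_cos_sq z

lemma sin_add_add_eq (x y z : ℝ) :
    sin (x + y + (z + x)) = sin (y + z) + 2 * cos (x + y + z) * sin x := by
  have e3 : x + y + (z + x) = (x + y + z) + x := by ring
  have e4 : y + z = (x + y + z) - x := by ring
  rw [e3, e4, sin_add, sin_sub]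
  ring

/-- The Hessian of the volume of the prism, with opposite sign. -/
lemma prism_hessian_pos {x y z v₁ v₂ v₃ : ℝ} (hxy : 0 < x + y) (hyz : 0 < y + z) (hzx : 0 < z + x)
    (hP : x + y + z < π / 2) (h : v₁ ≠ 0 ∨ v₂ ≠ 0 ∨ v₃ ≠ 0) :
    0 < sin (x + y + z) / cos (x + y + z) * (v₁ + v₂ + v₃) ^ 2
      + sin x / cos x * v₁ ^ 2 + sin y / cos y * v₂ ^ 2 + sin z / cos z * v₃ ^ 2
      + cos (x + y) / sin (x + y) * (v₁ + v₂) ^ 2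
      + cos (y + z) / sin (y + z) * (v₂ + v₃) ^ 2
      + cos (z + x) / sin (z + x) * (v₃ + v₁) ^ 2 := by
  have hpi := pi_pos
  have hc : 0 < cos (x + y + z) := cos_pos_of_mem_Ioo ⟨by linarith, hP⟩
  have hcx : 0 < cos x := cos_pos_of_mem_Ioo ⟨by linarith, by linarith⟩
  have hcy : 0 < cos y := cos_pos_of_mem_Ioo ⟨by linarith, by linarith⟩
  have hcz : 0 < cos z := cos_pos_of_mem_Ioo ⟨by linarith, by linarith⟩
  have hA : 0 < sin (y + z) := sin_pos_of_pos_of_lt_pi hyz (by linarith)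
  have hB : 0 < sin (z + x) := sin_pos_of_pos_of_lt_pi hzx (by linarith)
  have hC : 0 < sin (x + y) := sin_pos_of_pos_of_lt_pi hxy (by linarith)
  have hBC : 0 < sin (x + y + (z + x)) := sin_pos_of_pos_of_lt_pi (by linarith) (by linarith)
  have hABC : 0 < sin (2 * (x + y + z)) := sin_pos_of_pos_of_lt_pi (by linarith) (by linarith)
  have e1 : y + z + x = x + y + z := by ring
  have e2 : z + x + y = x + y + z := by ring
  -- Rescaling the variables this way makes all off-diagonal entries equal, up to a positive factor
  -- common to the whole form; `hid` below is this change of variables.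
  have q := ternary_form_pos (m := sin (x + y + (z + x)) / sin (y + z))
    (n := sin (x + y + (y + z)) / sin (z + x)) (k := sin (y + z + (z + x)) / sin (x + y))
    (x := sin (y + z) * v₁ / cos x) (y := sin (z + x) * v₂ / cos y) (z := sin (x + y) * v₃ / cos z)
    (by positivity) ?_ ?_ ?_
  · have hid : sin (x + y + z) / cos (x + y + z) * (v₁ + v₂ + v₃) ^ 2
      + sin x / cos x * v₁ ^ 2 + sin y / cos y * v₂ ^ 2 + sin z / cos z * v₃ ^ 2
      + cos (x + y) / sin (x + y) * (v₁ + v₂) ^ 2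
      + cos (y + z) / sin (y + z) * (v₂ + v₃) ^ 2
      + cos (z + x) / sin (z + x) * (v₃ + v₁) ^ 2 =
      (cos x * cos y * cos z / (cos (x + y + z) * sin (y + z) * sin (z + x) * sin (x + y))) *
      (sin (x + y + (z + x)) / sin (y + z) * (sin (y + z) * v₁ / cos x) ^ 2
       + sin (x + y + (y + z)) / sin (z + x) * (sin (z + x) * v₂ / cos y) ^ 2
       + sin (y + z + (z + x)) / sin (x + y) * (sin (x + y) * v₃ / cos z) ^ 2
       + 2 * ((sin (y + z) * v₁ / cos x) * (sin (z + x) * v₂ / cos y)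
         + (sin (z + x) * v₂ / cos y) * (sin (x + y) * v₃ / cos z)
         + (sin (x + y) * v₃ / cos z) * (sin (y + z) * v₁ / cos x))) := by
      have d1 := prism_hessian_diagonal hc.ne' hcx.ne' hC.ne' hB.ne'
      have d2 := prism_hessian_diagonal (x := y) (y := z) (z := x)
        (by rw [e1]; exact hc.ne') hcy.ne' hA.ne' hC.ne'
      have d3 := prism_hessian_diagonal (x := z) (y := x) (z := y)
        (by rw [e2]; exact hc.ne') hcz.ne' hB.ne' hA.ne'
      have o1 := tan_add_cot_add hc.ne' hC.ne'
      have o2 := tan_add_cot_add (x := y) (y := z) (z := x) (by rw [e1]; exact hc.ne') hA.ne'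
      have o3 := tan_add_cot_add (x := z) (y := x) (z := y) (by rw [e2]; exact hc.ne') hB.ne'
      rw [e1] at d2 o2
      rw [e2] at d3 o3
      rw [add_comm (y + z) (x + y)] at d2
      rw [add_comm (z + x) (y + z)] at d3
      have hr : cos x * cos y * cos z /
          (cos (x + y + z) * sin (y + z) * sin (z + x) * sin (x + y)) *
          (sin (x + y + (z + x)) / sin (y + z) * (sin (y + z) * v₁ / cos x) ^ 2
          + sin (x + y + (y + z)) / sin (z + x) * (sin (z + x) * v₂ / cos y) ^ 2
          + sin (y + z + (z + x)) / sin (x + y) * (sin (x + y) * v₃ / cos z) ^ 2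
          + 2 * ((sin (y + z) * v₁ / cos x) * (sin (z + x) * v₂ / cos y)
            + (sin (z + x) * v₂ / cos y) * (sin (x + y) * v₃ / cos z)
            + (sin (x + y) * v₃ / cos z) * (sin (y + z) * v₁ / cos x))) =
          cos y * cos z * sin (x + y + (z + x)) /
            (cos (x + y + z) * cos x * sin (z + x) * sin (x + y)) * v₁ ^ 2 +
          cos z * cos x * sin (x + y + (y + z)) /
            (cos (x + y + z) * cos y * sin (x + y) * sin (y + z)) * v₂ ^ 2 +
          cos x * cos y * sin (y + z + (z + x)) /
            (cos (x + y + z) * cos z * sin (y + z) * sin (z + x)) * v₃ ^ 2 +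
          2 * (cos z / (cos (x + y + z) * sin (x + y)) * (v₁ * v₂) +
            cos x / (cos (x + y + z) * sin (y + z)) * (v₂ * v₃) +
            cos y / (cos (x + y + z) * sin (z + x)) * (v₃ * v₁)) := by
        field_simp
      rw [hr, ← d1, ← d2, ← d3, ← o1, ← o2, ← o3]
      ring
    rw [hid]
    positivity
  · have : sin (x + y + (z + x)) / sin (y + z) * (sin (x + y + (y + z)) / sin (z + x)) - 1 =
        sin (x + y) * sin (2 * (x + y + z)) / (sin (y + z) * sin (z + x)) := by
      have := sin_add_mul_sin_add_sub (y + z) (z + x) (x + y)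
      rw [show y + z + (z + x) + (x + y) = 2 * (x + y + z) by ring] at this
      rw [← this]
      field_simp
    rw [this]; positivity
  · have : sin (x + y + (z + x)) / sin (y + z) * (sin (x + y + (y + z)) / sin (z + x)) *
        (sin (y + z + (z + x)) / sin (x + y)) + 2 - sin (x + y + (z + x)) / sin (y + z)
        - sin (x + y + (y + z)) / sin (z + x) - sin (y + z + (z + x)) / sin (x + y) =
        4 * cos (x + y + z) ^ 2 := by
      have s1 := sin_add_add_eq x y z
      have s2 := sin_add_add_eq y z x
      have s3 := sin_add_add_eq z x y
      rw [e1, add_comm (y + z)] at s2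
      rw [e2, add_comm (z + x)] at s3
      have g := sin_add_mul_sin_add_mul_sin_add x y z
      rw [s1, s2, s3]
      generalize cos (x + y + z) = c at *
      field_simp
      linear_combination 4 * c ^ 2 * g
    rw [this]; positivity
  · rcases h with h | h | h
    · left; positivity
    · right; left; positivity
    · right; right; positivity

lemma hasDerivAt_logSinhSq {X Y Z : ℝ → ℝ} {u v w r : ℝ} (hX : HasDerivAt X u r)
    (hY : HasDerivAt Y v r) (hZ : HasDerivAt Z w r) (hxy : 0 < X r + Y r) (hyz : 0 < Y r + Z r)
    (hzx : 0 < Z r + X r) (hP : X r + Y r + Z r < π / 2) :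
    HasDerivAt (fun r => logSinhSq (X r) (Y r) (Z r)) (
      -(sin (X r + Y r + Z r) / cos (X r + Y r + Z r) * (u + v + w)) - sin (X r) / cos (X r) * u
      - cos (Z r + X r) / sin (Z r + X r) * (w + u)
      - cos (X r + Y r) / sin (X r + Y r) * (u + v)) r := by
  have hpi := pi_pos
  have hc : cos (X r + Y r + Z r) ≠ 0 := (cos_pos_of_mem_Ioo ⟨by linarith, hP⟩).ne'
  have hcx : cos (X r) ≠ 0 := (cos_pos_of_mem_Ioo ⟨by linarith, by linarith⟩).ne'
  have hB : sin (X r + Z r) ≠ 0 := (sin_pos_of_pos_of_lt_pi (by linarith) (by linarith)).ne'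
  have hC : sin (X r + Y r) ≠ 0 := (sin_pos_of_pos_of_lt_pi hxy (by linarith)).ne'
  have h := ((((hX.fun_add hY).fun_add hZ).cos.log hc).fun_add (hX.cos.log hcx)).fun_sub
    ((hX.fun_add hZ).sin.log hB) |>.fun_sub ((hX.fun_add hY).sin.log hC)
  refine h.congr_deriv ?_
  rw [add_comm (Z r)]
  ring

/-- The gradient of the volume of a prism is strictly monotone. -/
lemma logSinhSq_strictMono {x y z x' y' z' : ℝ} (hxy : 0 < x + y) (hyz : 0 < y + z)
    (hzx : 0 < z + x) (hP : x + y + z < π / 2) (hxy' : 0 < x' + y') (hyz' : 0 < y' + z')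
    (hzx' : 0 < z' + x') (hP' : x' + y' + z' < π / 2) (hne : x' ≠ x ∨ y' ≠ y ∨ z' ≠ z) :
    (logSinhSq x' y' z' - logSinhSq x y z) * (x' - x)
      + (logSinhSq y' z' x' - logSinhSq y z x) * (y' - y)
      + (logSinhSq z' x' y' - logSinhSq z x y) * (z' - z) < 0 := by
  have hd : ∀ a a' r : ℝ, HasDerivAt (fun r : ℝ => a + r * (a' - a)) (a' - a) r := fun a a' r => by
    simpa using ((hasDerivAt_id r).mul_const (a' - a)).const_add a
  have hpos : ∀ a a' r : ℝ, 0 < a → 0 < a' → r ∈ Set.Icc (0 : ℝ) 1 → 0 < a + r * (a' - a) := by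
    intro a a' r ha ha' hr
    rcases hr.2.eq_or_lt with h | h
    · subst h; linarith
    · nlinarith [mul_nonneg hr.1 ha'.le, mul_pos (sub_pos.2 h) ha]
  set X : ℝ → ℝ := fun r => x + r * (x' - x) with hX
  set Y : ℝ → ℝ := fun r => y + r * (y' - y) with hY
  set Z : ℝ → ℝ := fun r => z + r * (z' - z) with hZ
  -- Along the segment joining the two points, which stays in the convex domain, the gradient paired
  -- with the direction has as derivative minus the form of `prism_hessian_pos`.
  have hder : ∀ r ∈ Set.Icc (0 : ℝ) 1, ∃ D < 0, HasDerivAt (fun r =>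
      logSinhSq (X r) (Y r) (Z r) * (x' - x) + logSinhSq (Y r) (Z r) (X r) * (y' - y)
        + logSinhSq (Z r) (X r) (Y r) * (z' - z)) D r := by
    intro r hr
    have h1 : 0 < X r + Y r := by
      have := hpos _ _ r hxy hxy' hr
      simp only [hX, hY]; linarith
    have h2 : 0 < Y r + Z r := by
      have := hpos _ _ r hyz hyz' hr
      simp only [hZ, hY]; linarith
    have h3 : 0 < Z r + X r := by
      have := hpos _ _ r hzx hzx' hr
      simp only [hX, hZ]; linarith
    have h4 : X r + Y r + Z r < π / 2 := by
      have := hpos _ _ r (sub_pos.2 hP) (sub_pos.2 hP') hr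
      simp only [hX, hY, hZ]; linarith
    have e1 : Y r + Z r + X r = X r + Y r + Z r := by ring
    have e2 : Z r + X r + Y r = X r + Y r + Z r := by ring
    have d1 := hasDerivAt_logSinhSq (hd x x' r) (hd y y' r) (hd z z' r) h1 h2 h3 h4
    have d2 := hasDerivAt_logSinhSq (hd y y' r) (hd z z' r) (hd x x' r) h2 h3 h1 (e1 ▸ h4)
    have d3 := hasDerivAt_logSinhSq (hd z z' r) (hd x x' r) (hd y y' r) h3 h1 h2 (e2 ▸ h4)
    have d := ((d1.mul_const (x' - x)).fun_add (d2.mul_const (y' - y))).fun_add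
      (d3.mul_const (z' - z))
    refine ⟨_, ?_, d⟩
    have q := prism_hessian_pos (v₁ := x' - x) (v₂ := y' - y) (v₃ := z' - z) h1 h2 h3 h4
      (by simpa [sub_ne_zero] using hne)
    simp only [hX, hY, hZ] at e1 e2 q ⊢
    rw [e1, e2]
    linarith
  have hanti : StrictAntiOn (fun r =>
      logSinhSq (X r) (Y r) (Z r) * (x' - x) + logSinhSq (Y r) (Z r) (X r) * (y' - y)
        + logSinhSq (Z r) (X r) (Y r) * (z' - z)) (Set.Icc 0 1) := by
    refine strictAntiOn_of_deriv_neg (convex_Icc 0 1) ?_ ?_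
    · intro r hr
      obtain ⟨D, -, h⟩ := hder r hr
      exact h.continuousAt.continuousWithinAt
    · intro r hr
      obtain ⟨D, hD, h⟩ := hder r (interior_subset hr)
      rwa [h.deriv]
  have := hanti (Set.left_mem_Icc.2 zero_le_one) (Set.right_mem_Icc.2 zero_le_one) zero_lt_one
  simp only [hX, hY, hZ, one_mul, zero_mul, add_zero, add_sub_cancel] at this
  linarith

namespace TriangularDecomposition

/-! ### Hyperbolic trigonometry -/

lemma coe_sub_conj_ne_zero (p q : ℍ) : (q : ℂ) - (starRingEnd ℂ) (p : ℂ) ≠ 0 := by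
  intro h
  have := congrArg Complex.im h
  simp at this
  linarith [p.im_pos, q.im_pos]

lemma norm_diskCoord (p q : ℍ) : ‖diskCoord p q‖ = tanh (dist p q / 2) := by
  rw [dist_comm, tanh_half_dist, diskCoord, norm_div, dist_eq_norm, dist_eq_norm]

/-- The difference of two values of a Möbius map factors, and the factors are half-distance
expressions. This is the third side of the Euclidean triangle used in `cosh_dist_eq`. -/
lemma norm_diskCoord_sub (p q r : ℍ) : ‖diskCoord p q - diskCoord p r‖ =
    sinh (dist q r / 2) / (cosh (dist p q / 2) * cosh (dist p r / 2)) := by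
  have h1 := coe_sub_conj_ne_zero p q
  have h2 := coe_sub_conj_ne_zero p r
  have hd : diskCoord p q - diskCoord p r = ((q : ℂ) - r) * (p - (starRingEnd ℂ) (p : ℂ)) /
      ((q - (starRingEnd ℂ) (p : ℂ)) * (r - (starRingEnd ℂ) (p : ℂ))) := by
    unfold diskCoord
    field_simp
    ring
  have hp : ‖(p : ℂ) - (starRingEnd ℂ) (p : ℂ)‖ = 2 * p.im := by
    rw [Complex.sub_conj]
    simp [abs_of_pos p.im_pos]
  rw [hd, norm_div, norm_mul, norm_mul, hp, dist_comm p q, dist_comm p r, sinh_half_dist,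
    cosh_half_dist, cosh_half_dist, dist_eq_norm, dist_eq_norm, dist_eq_norm]
  have n1 := norm_pos_iff.2 h1
  have n2 := norm_pos_iff.2 h2
  have ip := p.im_pos
  have iq := q.im_pos
  have ir := r.im_pos
  rw [sqrt_mul iq.le, sqrt_mul iq.le, sqrt_mul ir.le]
  have e := mul_self_sqrt ip.le
  have sp := sqrt_pos.2 ip
  have sq := sqrt_pos.2 iq
  have sr := sqrt_pos.2 ir
  field_simp
  linear_combination (-‖(q : ℂ) - r‖) * e

/-- The hyperbolic law of cosines. -/
lemma cosh_dist_eq (p q r : ℍ) : cosh (dist q r) =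
    cosh (dist p q) * cosh (dist p r) - sinh (dist p q) * sinh (dist p r) * cos (hypAngle p q r) := by
  -- The Euclidean law of cosines for the disk coordinates, where `p` is the origin; half-argument
  -- formulas turn it into the hyperbolic one.
  have h := InnerProductGeometry.norm_sub_sq_eq_norm_sq_add_norm_sq_sub_two_mul_norm_mul_norm_mul_cos_angle
    (diskCoord p q) (diskCoord p r)
  rw [norm_diskCoord_sub, norm_diskCoord, norm_diskCoord, tanh_eq_sinh_div_cosh,
    tanh_eq_sinh_div_cosh] at h
  have e : ∀ t : ℝ, cosh t = cosh (t / 2) ^ 2 + sinh (t / 2) ^ 2 := fun t => by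
    rw [← cosh_two_mul]; ring_nf
  have e' : ∀ t : ℝ, sinh t = 2 * sinh (t / 2) * cosh (t / 2) := fun t => by
    rw [← sinh_two_mul]; ring_nf
  rw [e (dist q r), e (dist p q), e (dist p r), e' (dist p q), e' (dist p r), hypAngle]
  have h1 := cosh_sq_sub_sinh_sq (dist q r / 2)
  have h2 := cosh_sq_sub_sinh_sq (dist p q / 2)
  have h3 := cosh_sq_sub_sinh_sq (dist p r / 2)
  have c1 := (cosh_pos (dist p q / 2)).ne'
  have c2 := (cosh_pos (dist p r / 2)).ne'
  generalize cos (InnerProductGeometry.angle (diskCoord p q) (diskCoord p r)) = x at *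
  generalize cosh (dist p q / 2) = C at *
  generalize cosh (dist p r / 2) = D at *
  generalize cosh (dist q r / 2) = E at *
  generalize sinh (dist p q / 2) = s at *
  generalize sinh (dist p r / 2) = t at *
  generalize sinh (dist q r / 2) = u at *
  field_simp at h
  linear_combination h1 + 2 * h - h2 * (D ^ 2 - t ^ 2) - h3

/-- The second hyperbolic law of cosines, deduced from the first one. -/
lemma mul_sin_mul_sin_of_law_of_cosines {A B C a b c : ℝ} (ha : 0 < a) (hb : 0 < b) (hc : 0 < c)
    (hB : B ∈ Set.Ioo 0 π) (hC : C ∈ Set.Ioo 0 π)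
    (h1 : cosh a = cosh b * cosh c - sinh b * sinh c * cos A)
    (h2 : cosh b = cosh c * cosh a - sinh c * sinh a * cos B)
    (h3 : cosh c = cosh a * cosh b - sinh a * sinh b * cos C) :
    cosh a * (sin B * sin C) = cos A + cos B * cos C := by
  have sa := sinh_pos_iff.2 ha
  have sb := sinh_pos_iff.2 hb
  have sc := sinh_pos_iff.2 hc
  have sB := sin_pos_of_mem_Ioo hB
  have sC := sin_pos_of_mem_Ioo hC
  have ea := cosh_sq a
  have eb := cosh_sq b
  have ec := cosh_sq c
  have eB := sin_sq_add_cos_sq B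
  have eC := sin_sq_add_cos_sq C
  generalize cosh a = x at *
  generalize cosh b = y at *
  generalize cosh c = z at *
  generalize sinh a = u at *
  generalize sinh b = v at *
  generalize sinh c = w at *
  generalize sin B = s at *
  generalize sin C = t at *
  generalize cos A = k at *
  generalize cos B = l at *
  generalize cos C = m at *
  have hl : l = (z * x - y) / (w * u) := by field_simp; linarith
  have hm : m = (x * y - z) / (u * v) := by field_simp; linarith
  have hk : k = (y * z - x) / (v * w) := by field_simp; linarith
  -- Both `u * w * s` and `u * v * t` are positive with the same symmetric expression as square.
  -- Hence they agree (the law of sines), which gives `s * t` without square roots.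
  have q1 : (u * w * s) ^ 2 = 1 + 2 * x * y * z - x ^ 2 - y ^ 2 - z ^ 2 := by
    have : (u * w * s) ^ 2 = u ^ 2 * w ^ 2 - (u * w * l) ^ 2 := by linear_combination u ^ 2 * w ^ 2 * eB
    rw [this, show u * w * l = z * x - y by rw [hl]; field_simp]
    linear_combination - (z ^ 2 - 1) * ea - u ^ 2 * ec
  have q2 : (u * v * t) ^ 2 = 1 + 2 * x * y * z - x ^ 2 - y ^ 2 - z ^ 2 := by
    have : (u * v * t) ^ 2 = u ^ 2 * v ^ 2 - (u * v * m) ^ 2 := by linear_combination u ^ 2 * v ^ 2 * eC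
    rw [this, show u * v * m = x * y - z by rw [hm]; field_simp]
    linear_combination - (y ^ 2 - 1) * ea - u ^ 2 * eb
  have q3 : u * w * s = u * v * t :=
    (pow_left_inj₀ (by positivity) (by positivity) two_ne_zero).1 (q1.trans q2.symm)
  have q4 : s * t = (1 + 2 * x * y * z - x ^ 2 - y ^ 2 - z ^ 2) / (u ^ 2 * v * w) := by
    field_simp
    linear_combination q1 - (u * w * s) * q3
  rw [q4, hk, hl, hm]
  field_simp
  linear_combination (y * z - x) * ea

/-- The second law of cosines implies the first one. -/
lemma law_of_cosines_of_mul_sin_mul_sin {A B C a b c : ℝ} (hb : 0 < b) (hc : 0 < c)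
    (hA : A ∈ Set.Ioo 0 π) (hB : B ∈ Set.Ioo 0 π) (hC : C ∈ Set.Ioo 0 π)
    (h1 : cosh a * (sin B * sin C) = cos A + cos B * cos C)
    (h2 : cosh b * (sin C * sin A) = cos B + cos C * cos A)
    (h3 : cosh c * (sin A * sin B) = cos C + cos A * cos B) :
    cosh a = cosh b * cosh c - sinh b * sinh c * cos A := by
  have sb := sinh_pos_iff.2 hb
  have sc := sinh_pos_iff.2 hc
  have sA := sin_pos_of_mem_Ioo hA
  have sB := sin_pos_of_mem_Ioo hB
  have sC := sin_pos_of_mem_Ioo hC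
  have eb := cosh_sq b
  have ec := cosh_sq c
  have eA := sin_sq_add_cos_sq A
  have eB := sin_sq_add_cos_sq B
  have eC := sin_sq_add_cos_sq C
  generalize cosh a = x at *
  generalize cosh b = y at *
  generalize cosh c = z at *
  generalize sinh b = v at *
  generalize sinh c = w at *
  generalize sin A = r at *
  generalize sin B = s at *
  generalize sin C = t at *
  generalize cos A = k at *
  generalize cos B = l at *
  generalize cos C = m at *
  have hx : x = (k + l * m) / (s * t) := by field_simp; linarith
  have hy : y = (l + m * k) / (t * r) := by field_simp; linarith
  have hz : z = (m + k * l) / (r * s) := by field_simp; linarith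
  -- The same device with the roles of angles and sides exchanged.
  have q1 : (t * r * v) ^ 2 = k ^ 2 + l ^ 2 + m ^ 2 + 2 * k * l * m - 1 := by
    have : (t * r * v) ^ 2 = (t * r * y) ^ 2 - t ^ 2 * r ^ 2 := by
      linear_combination - t ^ 2 * r ^ 2 * eb
    rw [this, show t * r * y = l + m * k by rw [hy]; field_simp]
    linear_combination - (1 - m ^ 2) * eA - r ^ 2 * eC
  have q2 : (r * s * w) ^ 2 = k ^ 2 + l ^ 2 + m ^ 2 + 2 * k * l * m - 1 := by
    have : (r * s * w) ^ 2 = (r * s * z) ^ 2 - r ^ 2 * s ^ 2 := by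
      linear_combination - r ^ 2 * s ^ 2 * ec
    rw [this, show r * s * z = m + k * l by rw [hz]; field_simp]
    linear_combination - (1 - l ^ 2) * eA - r ^ 2 * eB
  have q3 : t * r * v = r * s * w :=
    (pow_left_inj₀ (by positivity) (by positivity) two_ne_zero).1 (q1.trans q2.symm)
  have q4 : v * w = (k ^ 2 + l ^ 2 + m ^ 2 + 2 * k * l * m - 1) / (r ^ 2 * s * t) := by
    field_simp
    linear_combination q1 - (t * r * v) * q3
  rw [q4, hx, hy, hz]
  field_simp
  linear_combination (k + l * m) * eA

lemma IsHyperbolicTriangle.sideLength_pos {A : Fin 3 → ℝ} {P : Fin 3 → ℍ}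
    (h : IsHyperbolicTriangle A P) (i : Fin 3) : 0 < sideLength P i := by
  refine dist_pos.2 fun e => ?_
  have := h.1 e
  fin_cases i <;> simp at this

lemma IsHyperbolicTriangle.law_of_cosines {A : Fin 3 → ℝ} {P : Fin 3 → ℍ}
    (h : IsHyperbolicTriangle A P) (i : Fin 3) :
    cosh (sideLength P i) = cosh (sideLength P (i + 1)) * cosh (sideLength P (i + 2)) -
      sinh (sideLength P (i + 1)) * sinh (sideLength P (i + 2)) * cos (A i) := by
  have h1 : sideLength P (i + 1) = dist (P i) (P (i + 2)) := by
    rw [sideLength, dist_comm]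
    fin_cases i <;> rfl
  have h2 : sideLength P (i + 2) = dist (P i) (P (i + 1)) := by
    rw [sideLength]
    fin_cases i <;> rfl
  rw [h1, h2, ← h.2 i, sideLength, cosh_dist_eq (P i)]
  ring

/-- Subtracting `sin B * sin C` turns `cosh a` into `2 * sinh (a / 2) ^ 2` and the right side into
`cos A + cos (B + C)`, which factors. -/
lemma sinh_half_sq_mul {A B C a : ℝ} (h : cosh a * (sin B * sin C) = cos A + cos B * cos C) :
    sinh (a / 2) ^ 2 * (sin B * sin C) = cos ((A + B + C) / 2) * cos ((B + C - A) / 2) := by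
  have h1 : cosh a = 1 + 2 * sinh (a / 2) ^ 2 := by
    have h1 := cosh_two_mul (a / 2)
    have h2 := cosh_sq (a / 2)
    rw [mul_div_cancel₀ a two_ne_zero] at h1
    linarith
  have h2 : 2 * (cos ((A + B + C) / 2) * cos ((B + C - A) / 2)) = cos A + cos (B + C) := by
    rw [← mul_assoc, two_mul_cos_mul_cos]
    ring_nf
  rw [cos_add] at h2
  rw [h1] at h
  linarith

/-! ### Triangles with prescribed angles -/

/-- The point with given coordinate in the Poincaré disk centred at `I`. -/
lemma exists_diskCoord_I_eq {w : ℂ} (hw : ‖w‖ < 1) : ∃ q : ℍ, diskCoord UpperHalfPlane.I q = w := by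
  have hw1 : 1 - w ≠ 0 := fun h => by
    rw [← sub_eq_zero.1 h] at hw
    simp at hw
  -- The preimage is given by the inverse Cayley transform; this formula shows that it lies in the
  -- upper half-plane.
  have him : (Complex.I * (1 + w) / (1 - w)).im = (1 - ‖w‖ ^ 2) / ‖1 - w‖ ^ 2 := by
    rw [Complex.div_im, Complex.sq_norm, Complex.sq_norm, ← sub_div]
    congr 1
    simp [Complex.normSq_apply]
    ring
  have hpos : 0 < (Complex.I * (1 + w) / (1 - w)).im := by
    rw [him]
    have : 0 < ‖1 - w‖ := norm_pos_iff.2 hw1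
    have : ‖w‖ ^ 2 < 1 := by nlinarith [norm_nonneg w]
    have : 0 < 1 - ‖w‖ ^ 2 := by linarith
    positivity
  refine ⟨⟨_, hpos⟩, ?_⟩
  simp only [diskCoord, UpperHalfPlane.coe_I, Complex.conj_I]
  have h2 : Complex.I * (1 + w) / (1 - w) - -Complex.I ≠ 0 := by
    have : Complex.I * (1 + w) / (1 - w) - -Complex.I = 2 * Complex.I / (1 - w) := by
      field_simp; ring
    rw [this]
    simp [hw1]
  rw [div_eq_iff h2]
  field_simp
  ring

/-- Polar coordinates at `I`: the point at distance `t` in direction `α` has disk coordinate `tanh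
(t / 2) * exp (α * I)`, and the directions `0` and `A` are used. -/
lemma exists_hypAngle_eq {b c A : ℝ} (hb : 0 < b) (hc : 0 < c) (hA : A ∈ Set.Ioo 0 π) :
    ∃ p q r : ℍ, dist p q = c ∧ dist p r = b ∧ hypAngle p q r = A := by
  have ht : ∀ t : ℝ, 0 < t → 0 < tanh (t / 2) := fun t h => by
    rw [tanh_eq_sinh_div_cosh]
    exact div_pos (sinh_pos_iff.2 (by positivity)) (cosh_pos _)
  have key : ∀ t α : ℝ, 0 < t → ∃ q : ℍ, dist UpperHalfPlane.I q = t ∧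
      diskCoord UpperHalfPlane.I q = tanh (t / 2) • Complex.exp (α * Complex.I) := by
    intro t α h
    have hn : ‖tanh (t / 2) • Complex.exp (α * Complex.I)‖ = tanh (t / 2) := by
      rw [norm_smul, Complex.norm_exp_ofReal_mul_I, mul_one, norm_of_nonneg (ht t h).le]
    obtain ⟨q, hq⟩ := exists_diskCoord_I_eq (hn.trans_lt (tanh_lt_one _))
    refine ⟨q, ?_, hq⟩
    have := norm_diskCoord UpperHalfPlane.I q
    rw [hq, hn] at this
    linarith [tanh_injective this]
  obtain ⟨q, hq, hq'⟩ := key c 0 hc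
  obtain ⟨r, hr, hr'⟩ := key b A hb
  refine ⟨_, q, r, hq, hr, ?_⟩
  rw [hypAngle, hq', hr', InnerProductGeometry.angle_smul_left_of_pos _ _ (ht c hc),
    InnerProductGeometry.angle_smul_right_of_pos _ _ (ht b hb), Complex.ofReal_zero, zero_mul,
    Complex.exp_zero, Complex.angle_one_left (Complex.exp_ne_zero _), Complex.exp_mul_I,
    Complex.arg_cos_add_sin_mul_I ⟨by linarith [hA.1, pi_pos], hA.2.le⟩, abs_of_pos hA.1]

lemma eq_of_law_of_cosines {b c A A' : ℝ} (hb : 0 < b) (hc : 0 < c)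
    (hA : A ∈ Set.Icc 0 π) (hA' : A' ∈ Set.Icc 0 π)
    (h : cosh b * cosh c - sinh b * sinh c * cos A =
      cosh b * cosh c - sinh b * sinh c * cos A') : A = A' := by
  have sb := sinh_pos_iff.2 hb
  have sc := sinh_pos_iff.2 hc
  refine injOn_cos hA hA' (mul_left_cancel₀ (mul_pos sb sc).ne' ?_)
  linarith

lemma hypAngle_mem_Icc (p q r : ℍ) : hypAngle p q r ∈ Set.Icc 0 π :=
  ⟨InnerProductGeometry.angle_nonneg _ _, InnerProductGeometry.angle_le_pi _ _⟩

/-- From `A < π - (B + C)` one gets `cos A + cos (B + C) > 0`, so the value required of `cosh a`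
exceeds `1`. -/
lemma exists_cosh_mul_eq {A B C : ℝ} (hA : 0 < A) (hB : 0 < B) (hC : 0 < C) (h : A + B + C < π) :
    ∃ a, 0 < a ∧ cosh a * (sin B * sin C) = cos A + cos B * cos C := by
  have sB := sin_pos_of_mem_Ioo (x := B) ⟨hB, by linarith⟩
  have sC := sin_pos_of_mem_Ioo (x := C) ⟨hC, by linarith⟩
  have hBC : cos (π - (B + C)) < cos A :=
    cos_lt_cos_of_nonneg_of_le_pi hA.le (by linarith) (by linarith)
  rw [cos_pi_sub, cos_add] at hBC
  have h1 : 1 < (cos A + cos B * cos C) / (sin B * sin C) := by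
    rw [one_lt_div (by positivity)]
    linarith
  refine ⟨_, arcosh_pos h1, ?_⟩
  rw [cosh_arcosh h1.le]
  field_simp

/-- Three positive angles with sum less than `π` are the angles of a hyperbolic triangle. -/
lemma exists_isHyperbolicTriangle {A : Fin 3 → ℝ} (hA : ∀ i, 0 < A i)
    (hsum : A 0 + A 1 + A 2 < π) : ∃ P, IsHyperbolicTriangle A P := by
  have h0 := hA 0
  have h1 := hA 1
  have h2 := hA 2
  generalize hA0 : A 0 = α at *
  generalize hA1 : A 1 = β at *
  generalize hA2 : A 2 = γ at *
  obtain ⟨a, ha, ea⟩ := exists_cosh_mul_eq h0 h1 h2 hsum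
  obtain ⟨b, hb, eb⟩ := exists_cosh_mul_eq h1 h2 h0 (by linarith)
  obtain ⟨c, hc, ec⟩ := exists_cosh_mul_eq h2 h0 h1 (by linarith)
  have i0 : α ∈ Set.Ioo 0 π := ⟨h0, by linarith⟩
  have i1 : β ∈ Set.Ioo 0 π := ⟨h1, by linarith⟩
  have i2 : γ ∈ Set.Ioo 0 π := ⟨h2, by linarith⟩
  have l0 := law_of_cosines_of_mul_sin_mul_sin hb hc i0 i1 i2 ea eb ec
  have l1 := law_of_cosines_of_mul_sin_mul_sin hc ha i1 i2 i0 eb ec ea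
  have l2 := law_of_cosines_of_mul_sin_mul_sin ha hb i2 i0 i1 ec ea eb
  -- Only two sides and the enclosed angle are prescribed; the first law of cosines then forces the
  -- third side and the other two angles.
  obtain ⟨p, q, r, hpq, hpr, hang⟩ := exists_hypAngle_eq hb hc i0
  have hqr : dist q r = a := by
    have := cosh_dist_eq p q r
    rw [hpq, hpr, hang, mul_comm (cosh c), mul_comm (sinh c), ← l0] at this
    exact cosh_strictMonoOn.injOn dist_nonneg ha.le this
  have hq : hypAngle q r p = β := by
    refine eq_of_law_of_cosines hc ha (hypAngle_mem_Icc _ _ _) ⟨i1.1.le, i1.2.le⟩ ?_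
    rw [← l1, ← hpr, dist_comm p r, cosh_dist_eq q r p, hqr, dist_comm q p, hpq]
    ring
  have hr : hypAngle r p q = γ := by
    refine eq_of_law_of_cosines ha hb (hypAngle_mem_Icc _ _ _) ⟨i2.1.le, i2.2.le⟩ ?_
    rw [← l2, ← hpq, cosh_dist_eq r p q, dist_comm r q, hqr, dist_comm r p, hpr]
    ring
  have npq : p ≠ q := dist_pos.1 (hpq ▸ hc)
  have npr : p ≠ r := dist_pos.1 (hpr ▸ hb)
  have nqr : q ≠ r := dist_pos.1 (hqr ▸ ha)
  refine ⟨![p, q, r], ?_, ?_⟩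
  · intro i j hij
    fin_cases i <;> fin_cases j <;> first
      | rfl
      | exact absurd hij npq
      | exact absurd hij npr
      | exact absurd hij nqr
      | exact absurd hij.symm npq
      | exact absurd hij.symm npr
      | exact absurd hij.symm nqr
  · intro i
    fin_cases i
    · exact hang.trans hA0.symm
    · exact hq.trans hA1.symm
    · exact hr.trans hA2.symm

/-- The side lengths of a hyperbolic triangle in terms of its angles. -/
lemma IsHyperbolicTriangle.log_sinh_half_sq {A : Fin 3 → ℝ} {P : Fin 3 → ℍ}
    (h : IsHyperbolicTriangle A P) (hA : ∀ i, 0 < A i) (hsum : A 0 + A 1 + A 2 < π) (i : Fin 3) :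
    log (sinh (sideLength P i / 2) ^ 2) =
      logSinhSq ((A (i + 1) + A (i + 2) - A i) / 2) ((A (i + 2) + A i - A (i + 1)) / 2)
        ((A i + A (i + 1) - A (i + 2)) / 2) := by
  have hpi := pi_pos
  have h1 := h.law_of_cosines i
  have h2 := h.law_of_cosines (i + 1)
  have h3 := h.law_of_cosines (i + 2)
  have e1 : i + 1 + 1 = i + 2 := by rw [add_assoc]; rfl
  have e2 : i + 1 + 2 = i := by rw [add_assoc]; exact add_zero i
  have e3 : i + 2 + 1 = i := by rw [add_assoc]; exact add_zero i
  have e4 : i + 2 + 2 = i + 1 := by rw [add_assoc]; rfl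
  rw [e1, e2] at h2
  rw [e3, e4] at h3
  have hs : A i + A (i + 1) + A (i + 2) < π := by
    fin_cases i <;> simp <;> linarith
  have p0 := hA i
  have p1 := hA (i + 1)
  have p2 := hA (i + 2)
  have m1 : A (i + 1) ∈ Set.Ioo 0 π := ⟨p1, by linarith⟩
  have m2 : A (i + 2) ∈ Set.Ioo 0 π := ⟨p2, by linarith⟩
  have k := sinh_half_sq_mul (mul_sin_mul_sin_of_law_of_cosines (h.sideLength_pos i)
    (h.sideLength_pos _) (h.sideLength_pos _) m1 m2 h1 h2 h3)
  have s1 := sin_pos_of_mem_Ioo m1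
  have s2 := sin_pos_of_mem_Ioo m2
  have c1 : 0 < cos ((A i + A (i + 1) + A (i + 2)) / 2) :=
    cos_pos_of_mem_Ioo ⟨by linarith, by linarith⟩
  have c2 : 0 < cos ((A (i + 1) + A (i + 2) - A i) / 2) :=
    cos_pos_of_mem_Ioo ⟨by linarith, by linarith⟩
  have sh : 0 < sinh (sideLength P i / 2) := sinh_pos_iff.2 (half_pos (h.sideLength_pos i))
  have k' := congrArg log k
  rw [log_mul (by positivity) (by positivity), log_mul s1.ne' s2.ne',
    log_mul c1.ne' c2.ne'] at k'
  unfold logSinhSq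
  ring_nf at k' ⊢
  linarith

variable {F : Type*}

/-! ### Conformal classes in terms of the coordinates `ψ` -/

@[simp] lemma fstEnd_fstEnd (s : F × Fin 3) : fstEnd (fstEnd s) = sndEnd s := by
  simp only [fstEnd, sndEnd, add_assoc]; rfl

@[simp] lemma fstEnd_sndEnd (s : F × Fin 3) : fstEnd (sndEnd s) = s := by
  simp only [fstEnd, sndEnd, add_assoc]
  exact Prod.ext rfl (add_zero s.2)

@[simp] lemma sndEnd_fstEnd (s : F × Fin 3) : sndEnd (fstEnd s) = s := by
  simp only [fstEnd, sndEnd, add_assoc]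
  exact Prod.ext rfl (add_zero s.2)

@[simp] lemma sndEnd_sndEnd (s : F × Fin 3) : sndEnd (sndEnd s) = fstEnd s := by
  simp only [fstEnd, sndEnd, add_assoc]; rfl

lemma fstEnd_ne_sndEnd (s : F × Fin 3) : fstEnd s ≠ sndEnd s := by
  obtain ⟨t, i⟩ := s
  fin_cases i <;> simp [fstEnd, sndEnd]

/-- Recovers the angles from the `sidePsi`, which are therefore linear coordinates on the space of
angles. -/
lemma sidePsi_fstEnd_add_sidePsi_sndEnd (s : F × Fin 3) (x : F × Fin 3 → ℝ) :
    sidePsi (fstEnd s) x + sidePsi (sndEnd s) x = x s := by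
  simp only [sidePsi, fstEnd_fstEnd, fstEnd_sndEnd, sndEnd_fstEnd, sndEnd_sndEnd]
  ring

lemma sidePsi_add (s : F × Fin 3) (x y : F × Fin 3 → ℝ) :
    sidePsi s (x + y) = sidePsi s x + sidePsi s y := by
  simp only [sidePsi, Pi.add_apply]; ring

lemma sidePsi_sub (s : F × Fin 3) (x y : F × Fin 3 → ℝ) :
    sidePsi s (x - y) = sidePsi s x - sidePsi s y := by
  simp only [sidePsi, Pi.sub_apply]; ring

lemma sidePsi_smul (s : F × Fin 3) (r : ℝ) (x : F × Fin 3 → ℝ) :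
    sidePsi s (r • x) = r * sidePsi s x := by
  simp only [sidePsi, Pi.smul_apply, smul_eq_mul]; ring

lemma ext_sidePsi {x y : F × Fin 3 → ℝ} (h : ∀ s, sidePsi s x = sidePsi s y) : x = y := by
  funext s
  rw [← sidePsi_fstEnd_add_sidePsi_sndEnd s x, h, h, sidePsi_fstEnd_add_sidePsi_sndEnd]

-- The vectors `sideVector s` form the basis dual to the coordinates `sidePsi s`.
open Classical in
lemma sidePsi_sideVector (s s' : F × Fin 3) :
    sidePsi s' (sideVector s) = if s' = s then 1 else 0 := by
  obtain ⟨t, i⟩ := s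
  obtain ⟨t', i'⟩ := s'
  by_cases h : t' = t
  · subst h
    fin_cases i <;> fin_cases i' <;> simp [sidePsi, sideVector, fstEnd, sndEnd]
  · simp [sidePsi, sideVector, fstEnd, sndEnd, h]

/-- The permutation of the sides that exchanges glued sides. -/
def matePerm (T : TriangularDecomposition F) : Equiv.Perm (F × Fin 3) :=
  Function.Involutive.toPerm T.mate T.mate_mate

lemma sum_mate {M : Type*} [AddCommMonoid M] [Fintype F] (T : TriangularDecomposition F)
    (f : F × Fin 3 → M) : ∑ s, f (T.mate s) = ∑ s, f s :=
  Equiv.sum_comp T.matePerm f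

lemma sum_sidePsi_smul_sideVector [Fintype F] (x : F × Fin 3 → ℝ) :
    ∑ s, sidePsi s x • sideVector s = x := by
  classical
  have hs : ∀ s, ∀ S : Finset (F × Fin 3),
      sidePsi s (∑ s' ∈ S, sidePsi s' x • sideVector s') =
        ∑ s' ∈ S, sidePsi s (sidePsi s' x • sideVector s') := by
    intro s S
    induction S using Finset.induction_on with
    | empty => simp [sidePsi]
    | insert a S ha ih => rw [Finset.sum_insert ha, Finset.sum_insert ha, sidePsi_add, ih]
  refine ext_sidePsi fun s => ?_
  rw [hs]
  simp [sidePsi_smul, sidePsi_sideVector]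

lemma sidePsi_add_sidePsi_mate_of_mem (T : TriangularDecomposition F) {w : F × Fin 3 → ℝ}
    (hw : w ∈ T.conformalSpace) (s : F × Fin 3) : sidePsi s w + sidePsi (T.mate s) w = 0 := by
  classical
  induction hw using Submodule.span_induction with
  | mem w h =>
    obtain ⟨s', hs', rfl⟩ := h
    have h1 : T.mate s = s' ↔ s = T.mate s' := by
      constructor <;> rintro rfl <;> simp [T.mate_mate]
    have h2 : T.mate s = T.mate s' ↔ s = s' := T.matePerm.injective.eq_iff
    simp only [edgeVector, sidePsi_sub, sidePsi_sideVector, h1, h2]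
    ring
  | zero => simp [sidePsi]
  | add x y _ _ hx hy => rw [sidePsi_add, sidePsi_add]; linarith
  | smul r x _ hx => rw [sidePsi_smul, sidePsi_smul, ← mul_add, hx, mul_zero]

/-- In the dual basis, `w_e` is a basis vector minus its mate, so these vectors span everything
anti-invariant under `mate`. At a boundary side the condition reads `2 * sidePsi s w = 0`. -/
lemma mem_conformalSpace_iff [Fintype F] (T : TriangularDecomposition F) {w : F × Fin 3 → ℝ} :
    w ∈ T.conformalSpace ↔ ∀ s, sidePsi s w + sidePsi (T.mate s) w = 0 := by
  refine ⟨fun h => T.sidePsi_add_sidePsi_mate_of_mem h, fun h => ?_⟩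
  -- The factor `1 / 2` appears because each interior edge is met from both sides; boundary sides
  -- have zero edge vector.
  have h1 : w = (1 / 2 : ℝ) • ∑ s, sidePsi s w • T.edgeVector s := by
    have h2 : ∑ s, sidePsi s w • sideVector (T.mate s) = -w := by
      rw [← T.sum_mate]
      simp only [T.mate_mate]
      conv_rhs => rw [← sum_sidePsi_smul_sideVector w, ← Finset.sum_neg_distrib]
      refine Finset.sum_congr rfl fun s _ => ?_
      rw [eq_neg_of_add_eq_zero_right (h s)]
      exact neg_smul (sidePsi s w) (sideVector s)
    simp only [edgeVector, smul_sub, Finset.sum_sub_distrib]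
    rw [h2, sum_sidePsi_smul_sideVector]
    module
  rw [h1]
  refine Submodule.smul_mem _ _ (Submodule.sum_mem _ fun s _ => Submodule.smul_mem _ _ ?_)
  by_cases hs : T.mate s = s
  · simp [edgeVector, hs]
  · exact Submodule.subset_span ⟨s, hs, rfl⟩

lemma edgeOf_eq_iff (T : TriangularDecomposition F) (s s' : F × Fin 3) :
    T.edgeOf s' = T.edgeOf s ↔ s' = s ∨ s' = T.mate s := by
  rw [eq_comm]
  exact Quotient.eq (r := T.edgeSetoid)

lemma Psi_edgeOf_of_mate_ne [Fintype F] (T : TriangularDecomposition F) {s : F × Fin 3}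
    (hs : T.mate s ≠ s) (x : F × Fin 3 → ℝ) :
    T.Psi x (T.edgeOf s) = sidePsi s x + sidePsi (T.mate s) x := by
  classical
  simp only [Psi, edgeOf_eq_iff]
  rw [← Finset.sum_pair (f := fun s' => sidePsi s' x) hs.symm]
  congr 1
  ext s'
  simp

lemma Psi_edgeOf_of_mate_eq [Fintype F] (T : TriangularDecomposition F) {s : F × Fin 3}
    (hs : T.mate s = s) (x : F × Fin 3 → ℝ) : T.Psi x (T.edgeOf s) = sidePsi s x := by
  classical
  simp only [Psi, edgeOf_eq_iff, hs, or_self]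
  rw [← Finset.sum_singleton (fun s' => sidePsi s' x) s]
  congr 1
  ext s'
  simp

lemma Psi_eq_iff [Fintype F] (T : TriangularDecomposition F) (x y : F × Fin 3 → ℝ) :
    T.Psi x = T.Psi y ↔ T.ConformallyEquivalent y x := by
  rw [ConformallyEquivalent, mem_conformalSpace_iff]
  constructor
  · intro h s
    have := congrFun h (T.edgeOf s)
    rw [sidePsi_sub, sidePsi_sub]
    by_cases hs : T.mate s = s
    · rw [Psi_edgeOf_of_mate_eq T hs, Psi_edgeOf_of_mate_eq T hs] at this
      rw [hs]; linarith
    · rw [Psi_edgeOf_of_mate_ne T hs, Psi_edgeOf_of_mate_ne T hs] at this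
      linarith
  · intro h
    funext e
    obtain ⟨s, rfl⟩ := Quotient.exists_rep e
    change T.Psi x (T.edgeOf s) = T.Psi y (T.edgeOf s)
    have := h s
    rw [sidePsi_sub, sidePsi_sub] at this
    by_cases hs : T.mate s = s
    · rw [Psi_edgeOf_of_mate_eq T hs, Psi_edgeOf_of_mate_eq T hs]
      rw [hs] at this; linarith
    · rw [Psi_edgeOf_of_mate_ne T hs, Psi_edgeOf_of_mate_ne T hs]
      linarith

lemma isBoundaryEdge_edgeOf (T : TriangularDecomposition F) (s : F × Fin 3) :
    T.IsBoundaryEdge (T.edgeOf s) ↔ T.mate s = s := by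
  constructor
  · rintro ⟨s', h, hs'⟩
    rcases (T.edgeOf_eq_iff _ _).1 h with rfl | rfl
    · exact hs'
    · rw [T.mate_mate] at hs'
      exact hs'.symm
  · exact fun h => ⟨s, rfl, h⟩

/-- At a boundary side the sum is twice the coordinate, so boundary and interior edges can be
treated alike. -/
lemma sidePsi_add_mate_pos [Fintype F] (T : TriangularDecomposition F) {x : F × Fin 3 → ℝ}
    (hx : x ∈ T.delaunaySystems) (s : F × Fin 3) : 0 < sidePsi s x + sidePsi (T.mate s) x := by
  by_cases hs : T.mate s = s
  · have := (hx.2.2 _ ((T.isBoundaryEdge_edgeOf s).2 hs)).1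
    rw [Psi_edgeOf_of_mate_eq T hs] at this
    rw [hs]; linarith
  · have := (hx.2.1 _ (mt (T.isBoundaryEdge_edgeOf s).1 hs)).1
    rwa [Psi_edgeOf_of_mate_ne T hs] at this

/-! ### Angle sums in a conformal class -/

lemma angleSum_add [Fintype F] (T : TriangularDecomposition F) (v : T.Vertex)
    (x y : F × Fin 3 → ℝ) : T.angleSum v (x + y) = T.angleSum v x + T.angleSum v y := by
  simp [angleSum, Finset.sum_add_distrib]

lemma angleSum_sub [Fintype F] (T : TriangularDecomposition F) (v : T.Vertex)
    (x y : F × Fin 3 → ℝ) : T.angleSum v (x - y) = T.angleSum v x - T.angleSum v y := by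
  simp [angleSum, Finset.sum_sub_distrib]

open Classical in
lemma angleSum_sideVector [Fintype F] (T : TriangularDecomposition F) (v : T.Vertex)
    (s : F × Fin 3) : T.angleSum v (sideVector s) =
      (if T.vertexOf (fstEnd s) = v then 1 else 0) + if T.vertexOf (sndEnd s) = v then 1 else 0 := by
  have h : sideVector s = Pi.single (fstEnd s) 1 + Pi.single (sndEnd s) 1 := by
    funext c
    have := fstEnd_ne_sndEnd s
    by_cases h1 : c = fstEnd s
    · subst h1; simp [sideVector, this]
    · by_cases h2 : c = sndEnd s
      · subst h2; simp [sideVector, this.symm]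
      · simp [sideVector, h1, h2]
  rw [h, angleSum_add]
  simp [angleSum]

/-- Gluing identifies the endpoints of `s` with those of its mate, for either twist, so the entries
`1` and `-1` cancel at each vertex. -/
lemma angleSum_edgeVector [Fintype F] (T : TriangularDecomposition F) (v : T.Vertex)
    {s : F × Fin 3} (hs : T.mate s ≠ s) : T.angleSum v (T.edgeVector s) = 0 := by
  rw [edgeVector, angleSum_sub, angleSum_sideVector, angleSum_sideVector]
  cases ht : T.twist s
  · rw [show T.vertexOf (fstEnd s) = T.vertexOf (sndEnd (T.mate s)) from
      Quot.sound (CornerGlued.fst_snd s hs ht),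
      show T.vertexOf (sndEnd s) = T.vertexOf (fstEnd (T.mate s)) from
      Quot.sound (CornerGlued.snd_fst s hs ht)]
    ring
  · rw [show T.vertexOf (fstEnd s) = T.vertexOf (fstEnd (T.mate s)) from
      Quot.sound (CornerGlued.fst_fst s hs ht),
      show T.vertexOf (sndEnd s) = T.vertexOf (sndEnd (T.mate s)) from
      Quot.sound (CornerGlued.snd_snd s hs ht)]
    ring

lemma angleSum_eq_zero_of_mem [Fintype F] (T : TriangularDecomposition F) (v : T.Vertex)
    {w : F × Fin 3 → ℝ} (hw : w ∈ T.conformalSpace) : T.angleSum v w = 0 := by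
  induction hw using Submodule.span_induction with
  | mem w h =>
    obtain ⟨s, hs, rfl⟩ := h
    exact T.angleSum_edgeVector v hs
  | zero => simp [angleSum]
  | add x y _ _ hx hy => rw [angleSum_add, hx, hy, add_zero]
  | smul r x _ hx =>
    simp only [angleSum, Pi.smul_apply, smul_eq_mul, ← Finset.mul_sum] at hx ⊢
    rw [hx, mul_zero]

lemma mem_angleFlat_of_conformallyEquivalent [Fintype F] (T : TriangularDecomposition F)
    {x u : F × Fin 3 → ℝ} (h : T.ConformallyEquivalent x u) (hx : x ∈ T.angleFlat) :
    u ∈ T.angleFlat := by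
  have key : ∀ v, T.angleSum v u = T.angleSum v x := fun v => by
    have := T.angleSum_eq_zero_of_mem v h
    rw [angleSum_sub] at this
    linarith
  exact ⟨fun v hv => (key v).trans (hx.1 v hv), fun v hv => (key v).trans (hx.2 v hv)⟩

/-! ### Uniform angle systems -/

/-- The logarithm of `sinh² (a / 2)`, where `a` is the length that the angles `u` give to the side
`s`. -/
noncomputable def sideLog (u : F × Fin 3 → ℝ) (s : F × Fin 3) : ℝ :=
  logSinhSq (sidePsi s u) (sidePsi (fstEnd s) u) (sidePsi (sndEnd s) u)

/-- Angles determine side lengths through `log_sinh_half_sq`, and `log (sinh (a / 2) ^ 2)` is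
injective in `a > 0`. In the converse direction the triangles come from
`exists_isHyperbolicTriangle`. -/
lemma isUniform_iff [Fintype F] (T : TriangularDecomposition F) {u : F × Fin 3 → ℝ}
    (hu : u ∈ T.angleSystems) : T.IsUniform u ↔ ∀ s, sideLog u (T.mate s) = sideLog u s := by
  have hpos : ∀ t i, 0 < u (t, i) := fun t i => (hu.2.2 (t, i)).1
  have hsum : ∀ t, u (t, 0) + u (t, 1) + u (t, 2) < π := fun t => by
    have := hu.2.1 t
    unfold curvature at this
    linarith
  have key : ∀ P : F → Fin 3 → ℍ, (∀ t, IsHyperbolicTriangle (fun i => u (t, i)) (P t)) →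
      ∀ s, log (sinh (sideLength (P s.1) s.2 / 2) ^ 2) = sideLog u s := by
    intro P hP s
    rw [(hP s.1).log_sinh_half_sq (hpos s.1) (hsum s.1) s.2, sideLog, sidePsi, sidePsi, sidePsi]
    simp only [fstEnd_fstEnd, fstEnd_sndEnd, sndEnd_fstEnd, sndEnd_sndEnd]
    rfl
  constructor
  · rintro ⟨-, P, hP, h⟩ s
    rw [← key P hP, ← key P hP, h s]
  · intro h
    choose P hP using fun t => exists_isHyperbolicTriangle (A := fun i => u (t, i)) (hpos t)
      (hsum t)
    refine ⟨hu, P, hP, fun s => ?_⟩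
    have h1 := (hP s.1).sideLength_pos s.2
    have h2 := (hP (T.mate s).1).sideLength_pos (T.mate s).2
    have s1 := sinh_pos_iff.2 (half_pos h1)
    have s2 := sinh_pos_iff.2 (half_pos h2)
    have e := h s
    rw [← key P hP, ← key P hP] at e
    have e' := log_injOn_pos (Set.mem_Ioi.2 (by positivity)) (Set.mem_Ioi.2 (by positivity)) e
    have e'' := sinh_injective ((pow_left_inj₀ s2.le s1.le two_ne_zero).1 e')
    linarith

/-! ### The volume of the ideal prisms -/

lemma curvature_eq (s : F × Fin 3) (x : F × Fin 3 → ℝ) :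
    curvature s.1 x = x s + x (fstEnd s) + x (sndEnd s) - π := by
  obtain ⟨t, i⟩ := s
  fin_cases i <;> simp [curvature, fstEnd, sndEnd] <;> ring

lemma curvature_eq_sidePsi (s : F × Fin 3) (x : F × Fin 3 → ℝ) :
    -curvature s.1 x / 2 = π / 2 - (sidePsi s x + sidePsi (fstEnd s) x + sidePsi (sndEnd s) x) := by
  rw [curvature_eq, sidePsi, sidePsi, sidePsi]
  simp only [fstEnd_fstEnd, fstEnd_sndEnd, sndEnd_fstEnd, sndEnd_sndEnd]
  ring

/-- The dihedral angles (up to a factor) whose Lobachevsky functions add up to the volume of the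
ideal prisms over the triangles with angles `x`. -/
noncomputable def prismAngle (x : F × Fin 3 → ℝ) : (F × Fin 3) ⊕ (F × Fin 3) ⊕ F → ℝ :=
  Sum.elim x (Sum.elim (fun s => π / 2 - sidePsi s x) fun t => -curvature t x / 2)

/-- The linear part of `prismAngle`. -/
noncomputable def prismAngleVariation (w : F × Fin 3 → ℝ) : (F × Fin 3) ⊕ (F × Fin 3) ⊕ F → ℝ :=
  Sum.elim w (Sum.elim (fun s => - sidePsi s w) fun t => -(w (t, 0) + w (t, 1) + w (t, 2)) / 2)

lemma prismAngle_add_smul (x w : F × Fin 3 → ℝ) (r : ℝ) (j : (F × Fin 3) ⊕ (F × Fin 3) ⊕ F) :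
    prismAngle (x + r • w) j = prismAngle x j + r * prismAngleVariation w j := by
  rcases j with s | s | t
  · simp [prismAngle, prismAngleVariation]
  · simp only [prismAngle, prismAngleVariation, Sum.elim_inl, Sum.elim_inr, sidePsi_add,
      sidePsi_smul]
    ring
  · simp only [prismAngle, prismAngleVariation, Sum.elim_inr, curvature,
      Pi.add_apply, Pi.smul_apply, smul_eq_mul]
    ring

lemma prismAngleVariation_sub (x y : F × Fin 3 → ℝ) (j : (F × Fin 3) ⊕ (F × Fin 3) ⊕ F) :
    prismAngleVariation (x - y) j = prismAngle x j - prismAngle y j := by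
  have := prismAngle_add_smul y (x - y) 1 j
  rw [one_smul, add_sub_cancel, one_mul] at this
  linarith

lemma continuous_prismAngle (j : (F × Fin 3) ⊕ (F × Fin 3) ⊕ F) :
    Continuous fun x : F × Fin 3 → ℝ => prismAngle x j := by
  rcases j with s | s | t <;> simp only [prismAngle, Sum.elim_inl, Sum.elim_inr, sidePsi, curvature]
    <;> fun_prop

/-- Twice the sum of the volumes of the ideal prisms, up to terms that do not matter here. -/
noncomputable def prismVolume [Fintype F] (x : F × Fin 3 → ℝ) : ℝ :=
  ∑ j, lobachevsky (prismAngle x j)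

lemma continuous_prismVolume [Fintype F] : Continuous (prismVolume (F := F)) :=
  continuous_finsetSum _ fun j _ => continuous_lobachevsky.comp (continuous_prismAngle j)

lemma sideLog_eq (u : F × Fin 3 → ℝ) (s : F × Fin 3) : sideLog u s =
    log (sin (-curvature s.1 u / 2)) + log (sin (π / 2 - sidePsi s u)) - log (sin (u (fstEnd s)))
      - log (sin (u (sndEnd s))) := by
  rw [curvature_eq_sidePsi, sin_pi_div_two_sub, sin_pi_div_two_sub,
    ← sidePsi_fstEnd_add_sidePsi_sndEnd (fstEnd s) u, ← sidePsi_fstEnd_add_sidePsi_sndEnd (sndEnd s) u,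
    sideLog, logSinhSq]
  simp only [fstEnd_fstEnd, fstEnd_sndEnd, sndEnd_fstEnd, sndEnd_sndEnd]
  rw [add_comm (sidePsi (sndEnd s) u)]

/-- Regrouping by the coordinates `sidePsi s w`: each occurs in the variation of the two corners
adjacent to `s`, of its own dihedral angle and of the curvature, and the four logarithms form
`sideLog u s`. -/
lemma sum_log_sin_prismAngle [Fintype F] (u w : F × Fin 3 → ℝ) :
    ∑ j, -log (sin (prismAngle u j)) * prismAngleVariation w j =
      ∑ s, sideLog u s * sidePsi s w := by
  rw [Fintype.sum_sum_type, Fintype.sum_sum_type, Fintype.sum_prod_type, Fintype.sum_prod_type,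
    Fintype.sum_prod_type, ← Finset.sum_add_distrib, ← Finset.sum_add_distrib]
  refine Finset.sum_congr rfl fun t _ => ?_
  simp only [Fin.sum_univ_three, prismAngle, prismAngleVariation, Sum.elim_inl, Sum.elim_inr,
    sideLog_eq, sidePsi]
  have f0 : fstEnd (t, 0) = (t, 1) := rfl
  have f1 : fstEnd (t, 1) = (t, 2) := rfl
  have f2 : fstEnd (t, 2) = (t, 0) := rfl
  have g0 : sndEnd (t, 0) = (t, 2) := rfl
  have g1 : sndEnd (t, 1) = (t, 0) := rfl
  have g2 : sndEnd (t, 2) = (t, 1) := rfl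
  rw [f0, f1, f2, g0, g1, g2]
  ring

lemma hasDerivAt_prismVolume [Fintype F] {u : F × Fin 3 → ℝ}
    (hu : ∀ j, prismAngle u j ∈ Set.Ioo 0 π) (w : F × Fin 3 → ℝ) :
    HasDerivAt (fun r : ℝ => prismVolume (u + r • w)) (∑ s, sideLog u s * sidePsi s w) 0 := by
  rw [← sum_log_sin_prismAngle]
  simp only [prismVolume, prismAngle_add_smul]
  refine HasDerivAt.fun_sum fun j _ => ?_
  have hl : HasDerivAt (fun r : ℝ => prismAngle u j + r * prismAngleVariation w j)
      (prismAngleVariation w j) 0 := by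
    simpa using ((hasDerivAt_id (0 : ℝ)).mul_const (prismAngleVariation w j)).const_add
      (prismAngle u j)
  exact HasDerivAt.comp (0 : ℝ) (h₂ := lobachevsky)
    (by simpa using hasDerivAt_lobachevsky (hu j).1 (hu j).2) hl

lemma sum_mul_sidePsi_edgeVector [Fintype F] (T : TriangularDecomposition F) (f : F × Fin 3 → ℝ)
    (s : F × Fin 3) : ∑ s', f s' * sidePsi s' (T.edgeVector s) = f s - f (T.mate s) := by
  classical
  simp [edgeVector, sidePsi_sub, sidePsi_sideVector, mul_sub, Finset.sum_sub_distrib]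

/-! ### Uniqueness -/

lemma eq_of_sideLog_mate [Fintype F] (T : TriangularDecomposition F) {u u' : F × Fin 3 → ℝ}
    (hu : u ∈ T.angleSystems) (hu' : u' ∈ T.angleSystems)
    (h : ∀ s, sideLog u (T.mate s) = sideLog u s) (h' : ∀ s, sideLog u' (T.mate s) = sideLog u' s)
    (hc : T.ConformallyEquivalent u' u) : u' = u := by
  have hanti := T.mem_conformalSpace_iff.1 hc
  simp only [sidePsi_sub] at hanti
  -- Under `mate` the first factor is invariant and the second changes sign, so the sum equals its
  -- own negative.
  have hzero : ∑ s, (sideLog u' s - sideLog u s) * (sidePsi s u' - sidePsi s u) = 0 := by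
    have h1 := T.sum_mate fun s => (sideLog u' s - sideLog u s) * (sidePsi s u' - sidePsi s u)
    have h2 : ∀ s, (sideLog u' (T.mate s) - sideLog u (T.mate s)) *
        (sidePsi (T.mate s) u' - sidePsi (T.mate s) u) =
        -((sideLog u' s - sideLog u s) * (sidePsi s u' - sidePsi s u)) := fun s => by
      rw [h, h', eq_neg_of_add_eq_zero_right (hanti s)]
      ring
    simp only [h2, Finset.sum_neg_distrib] at h1
    linarith
  -- Strict concavity triangle by triangle: a triangle on which `u` and `u'` differ would make the
  -- vanishing sum negative.
  have htri : ∀ t, (∃ i, sidePsi (t, i) u' ≠ sidePsi (t, i) u) →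
      ∑ i, (sideLog u' (t, i) - sideLog u (t, i)) * (sidePsi (t, i) u' - sidePsi (t, i) u) < 0 := by
    rintro t hne
    have hpos : ∀ v ∈ T.angleSystems, ∀ s, 0 < sidePsi (fstEnd s) v + sidePsi (sndEnd s) v :=
      fun v hv s => by
        rw [sidePsi_fstEnd_add_sidePsi_sndEnd]; exact (hv.2.2 s).1
    have hP : ∀ v ∈ T.angleSystems, sidePsi (t, 0) v + sidePsi (t, 1) v + sidePsi (t, 2) v < π / 2 :=
      fun v hv => by
        have h1 := curvature_eq_sidePsi (t, 0) v
        have h2 := hv.2.1 t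
        change -curvature t v / 2 =
          π / 2 - (sidePsi (t, 0) v + sidePsi (t, 1) v + sidePsi (t, 2) v) at h1
        linarith
    rw [Fin.sum_univ_three]
    exact logSinhSq_strictMono (hpos u hu (t, 2)) (hpos u hu (t, 0)) (hpos u hu (t, 1)) (hP u hu)
      (hpos u' hu' (t, 2)) (hpos u' hu' (t, 0)) (hpos u' hu' (t, 1)) (hP u' hu')
      (by
        change sidePsi (t, 0) u' ≠ sidePsi (t, 0) u ∨ sidePsi (t, 1) u' ≠ sidePsi (t, 1) u ∨
          sidePsi (t, 2) u' ≠ sidePsi (t, 2) u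
        simpa [Fin.exists_fin_succ] using hne)
  have hle : ∀ t, ∑ i, (sideLog u' (t, i) - sideLog u (t, i)) *
      (sidePsi (t, i) u' - sidePsi (t, i) u) ≤ 0 := by
    intro t
    by_cases hne : ∃ i, sidePsi (t, i) u' ≠ sidePsi (t, i) u
    · exact (htri t hne).le
    · push Not at hne
      simp [hne]
  rw [Fintype.sum_prod_type, Finset.sum_eq_zero_iff_of_nonpos fun t _ => hle t] at hzero
  refine ext_sidePsi fun s => ?_
  by_contra hs
  exact (htri s.1 ⟨s.2, hs⟩).ne (hzero s.1 (Finset.mem_univ _))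

/-! ### Existence -/

/-- The closure of the set of the angle systems in the conformal class of `x`. -/
def closedConformalClass (T : TriangularDecomposition F) (x : F × Fin 3 → ℝ) :
    Set (F × Fin 3 → ℝ) :=
  {u | T.ConformallyEquivalent x u ∧ (∀ s, 0 ≤ u s) ∧ ∀ t, curvature t u ≤ 0}

lemma isCompact_closedConformalClass [Fintype F] (T : TriangularDecomposition F)
    (x : F × Fin 3 → ℝ) : IsCompact (T.closedConformalClass x) := by
  refine (isCompact_Icc (a := (0 : F × Fin 3 → ℝ)) (b := fun _ => π)).of_isClosed_subset ?_ ?_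
  · have h1 : IsClosed {u | T.ConformallyEquivalent x u} :=
      T.conformalSpace.closed_of_finiteDimensional.preimage
        (f := fun u : F × Fin 3 → ℝ => x - u) (by fun_prop)
    have h2 : IsClosed {u : F × Fin 3 → ℝ | ∀ s, 0 ≤ u s} := by
      simp only [Set.ofPred_forall]
      exact isClosed_iInter fun s => isClosed_le continuous_const (continuous_apply s)
    have h3 : IsClosed {u : F × Fin 3 → ℝ | ∀ t, curvature t u ≤ 0} := by
      simp only [Set.ofPred_forall, curvature]
      exact isClosed_iInter fun t => isClosed_le (by fun_prop) continuous_const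
    exact h1.inter (h2.inter h3)
  · rintro u ⟨-, h0, hs⟩
    refine ⟨h0, fun s => ?_⟩
    have := hs s.1
    rw [curvature_eq] at this
    linarith [h0 (fstEnd s), h0 (sndEnd s)]

/-- For the middle family, with `A` opposite to the side, `B + C - A ≤ π - 2 * A ≤ π`. -/
lemma prismAngle_nonneg {u : F × Fin 3 → ℝ} (h0 : ∀ s, 0 ≤ u s) (hs : ∀ t, curvature t u ≤ 0)
    (j : (F × Fin 3) ⊕ (F × Fin 3) ⊕ F) : 0 ≤ prismAngle u j := by
  rcases j with s | s | t
  · exact h0 s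
  · have := hs s.1
    rw [curvature_eq] at this
    simp only [prismAngle, Sum.elim_inl, Sum.elim_inr, sidePsi]
    linarith [h0 s]
  · simp only [prismAngle, Sum.elim_inr]
    linarith [hs t]

lemma prismAngle_pos [Fintype F] (T : TriangularDecomposition F) {u : F × Fin 3 → ℝ}
    (hu : u ∈ T.angleSystems) (j : (F × Fin 3) ⊕ (F × Fin 3) ⊕ F) : 0 < prismAngle u j := by
  rcases j with s | s | t
  · exact (hu.2.2 s).1
  · have := hu.2.1 s.1
    rw [curvature_eq] at this
    simp only [prismAngle, Sum.elim_inl, Sum.elim_inr, sidePsi]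
    linarith [(hu.2.2 s).1]
  · simp only [prismAngle, Sum.elim_inr]
    linarith [hu.2.1 t]

lemma nonneg_of_prismAngle_nonneg {u : F × Fin 3 → ℝ} (h : ∀ j, 0 ≤ prismAngle u j) :
    (∀ s, 0 ≤ u s) ∧ ∀ t, curvature t u ≤ 0 := by
  refine ⟨fun s => h (Sum.inl s), fun t => ?_⟩
  have := h (Sum.inr (Sum.inr t))
  simp only [prismAngle, Sum.elim_inr] at this
  linarith

/-- The Delaunay condition excludes the degenerate triangles with angles `π`, `0`, `0`. -/
lemma prismAngle_lt_pi [Fintype F] (T : TriangularDecomposition F) {x u : F × Fin 3 → ℝ}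
    (hx : x ∈ T.delaunaySystems) (hu : u ∈ T.closedConformalClass x)
    -- The coordinate of the mate is at most `π / 2` and the two coordinates have positive sum,
    -- hence each exceeds `-(π / 2)`; an angle `π` would force the value `-(π / 2)` at the opposite
    -- side.
    (j : (F × Fin 3) ⊕ (F × Fin 3) ⊕ F) : prismAngle u j < π := by
  obtain ⟨hc, h0, hs⟩ := hu
  have hpsi : ∀ s, -(π / 2) < sidePsi s u := fun s => by
    have h1 := T.sidePsi_add_mate_pos hx s
    have h2 := T.mem_conformalSpace_iff.1 hc s
    rw [sidePsi_sub, sidePsi_sub] at h2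
    have h3 := prismAngle_nonneg h0 hs (Sum.inr (Sum.inl (T.mate s)))
    simp only [prismAngle, Sum.elim_inl, Sum.elim_inr] at h3
    linarith
  rcases j with s | s | t
  · have h1 := hpsi s
    have h2 := hs s.1
    rw [curvature_eq] at h2
    simp only [prismAngle, Sum.elim_inl]
    rw [sidePsi] at h1
    linarith
  · simp only [prismAngle, Sum.elim_inl, Sum.elim_inr]
    linarith [hpsi s]
  · simp only [prismAngle, Sum.elim_inr, curvature]
    linarith [h0 (t, 0), h0 (t, 1), h0 (t, 2), pi_pos]

lemma exists_uniform [Fintype F] (T : TriangularDecomposition F) {x : F × Fin 3 → ℝ}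
    (hx : x ∈ T.delaunaySystems) : ∃ u, T.IsUniform u ∧ T.ConformallyEquivalent x u := by
  have hxK : x ∈ T.closedConformalClass x :=
    ⟨by simp [ConformallyEquivalent], fun s => (hx.1.2.2 s).1.le, fun t => (hx.1.2.1 t).le⟩
  obtain ⟨u, huK, hmax⟩ := (T.isCompact_closedConformalClass x).exists_isMaxOn ⟨x, hxK⟩
    continuous_prismVolume.continuousOn
  -- Moving from `u` towards `x`, where all prism angles are positive, would increase the volume if
  -- some prism angle of `u` vanished.
  have hpos : ∀ j, 0 < prismAngle u j := by
    refine pos_of_sum_lobachevsky_le _ (prismAngle x) (prismAngle_nonneg huK.2.1 huK.2.2)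
      (T.prismAngle_lt_pi hx huK) (T.prismAngle_pos hx.1) fun s hs => ?_
    have hmem : u + s • (x - u) ∈ T.closedConformalClass x := by
      refine ⟨?_, nonneg_of_prismAngle_nonneg fun j => ?_⟩
      · have : x - (u + s • (x - u)) = (1 - s) • (x - u) := by module
        rw [ConformallyEquivalent, this]
        exact Submodule.smul_mem _ _ huK.1
      · rw [prismAngle_add_smul, prismAngleVariation_sub]
        have h1 := prismAngle_nonneg huK.2.1 huK.2.2 j
        have h2 := T.prismAngle_pos hx.1 j
        nlinarith [mul_nonneg (sub_nonneg.2 hs.2.le) h1, mul_pos hs.1 h2]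
    have : prismVolume (u + s • (x - u)) ≤ prismVolume u := hmax hmem
    simpa only [prismVolume, prismAngle_add_smul, prismAngleVariation_sub] using this
  have hIoo : ∀ j, prismAngle u j ∈ Set.Ioo 0 π := fun j => ⟨hpos j, T.prismAngle_lt_pi hx huK j⟩
  have hu : u ∈ T.angleSystems := by
    refine ⟨T.mem_angleFlat_of_conformallyEquivalent huK.1 hx.1.1, fun t => ?_,
      fun s => hIoo (Sum.inl s)⟩
    have := hpos (Sum.inr (Sum.inr t))
    simp only [prismAngle, Sum.elim_inr] at this
    linarith
  refine ⟨u, (T.isUniform_iff hu).2 fun s => ?_, huK.1⟩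
  by_cases hs : T.mate s = s
  · rw [hs]
  -- Being away from the boundary, `u` is a two-sided local maximum along `w_e`; the vanishing
  -- derivative is the jump of `sideLog` across the edge.
  have hd := hasDerivAt_prismVolume hIoo (T.edgeVector s)
  have hloc : IsLocalMax (fun r : ℝ => prismVolume (u + r • T.edgeVector s)) 0 := by
    have hev : ∀ j, ∀ᶠ r : ℝ in 𝓝 0, 0 < prismAngle (u + r • T.edgeVector s) j := fun j => by
      have hcont : Continuous fun r : ℝ => prismAngle (u + r • T.edgeVector s) j :=
        (continuous_prismAngle j).comp (by fun_prop)
      refine hcont.continuousAt.eventually (lt_mem_nhds ?_)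
      simpa using hpos j
    filter_upwards [eventually_all.2 hev] with r hr
    rw [zero_smul, add_zero]
    refine hmax ⟨?_, nonneg_of_prismAngle_nonneg fun j => (hr j).le⟩
    rw [ConformallyEquivalent, ← sub_sub]
    exact Submodule.sub_mem _ huK.1
      (Submodule.smul_mem _ _ (Submodule.subset_span ⟨s, hs, rfl⟩))
  have := hloc.hasDerivAt_eq_zero hd
  rw [sum_mul_sidePsi_edgeVector] at this
  linarith

end TriangularDecomposition

end

/-! ### The theorem -/

theorem corollary2p6 {F : Type*} [Fintype F] (T : TriangularDecomposition F)
    (x : F × Fin 3 → ℝ) (hx : x ∈ T.delaunaySystems) :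
    (∃! u : F × Fin 3 → ℝ, T.IsUniform u ∧ T.ConformallyEquivalent x u) ∧
      T.IsIdealDiskPattern (T.Psi x) ∧
      ∃! u : F × Fin 3 → ℝ, T.IsUniform u ∧ T.Psi u = T.Psi x := by
  have h : ∃! u : F × Fin 3 → ℝ, T.IsUniform u ∧ T.ConformallyEquivalent x u := by
    obtain ⟨u, hu, hxu⟩ := T.exists_uniform hx
    refine ⟨u, ⟨hu, hxu⟩, fun u' ⟨hu', hxu'⟩ => ?_⟩
    refine T.eq_of_sideLog_mate hu.1 hu'.1 ((T.isUniform_iff hu.1).1 hu)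
      ((T.isUniform_iff hu'.1).1 hu') ?_
    have := Submodule.sub_mem _ hxu hxu'
    rwa [sub_sub_sub_cancel_left] at this
  simp only [T.Psi_eq_iff]
  obtain ⟨u, ⟨hu, hxu⟩, -⟩ := id h
  exact ⟨h, ⟨u, hu, (T.Psi_eq_iff u x).2 hxu⟩, h⟩
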